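/- Let $b,\sigma,v$ be continuously differentiable functions on $(0,\infty)$ with $\sigma(x)\neq 0$ for all $x>0$, let $\xi>0$ and $r\in\mathbb{R}$, and put $k:=b-\sigma v$ and $$\mathcal{L}\phi(x)=\tfrac12\sigma^2(x)\phi''(x)+k(x)\phi'(x)-r\,\phi(x).$$ Let $\mathcal{C}$ be the set of all tuples $(\lambda,h'(\xi))\in\mathbb{R}^2$ where $h\in C^2(0,\infty)$ satisfies $\mathcal{L}h=-\lambda h$, $h>0$ on $(0,\infty)$ and $h(\xi)=1$; the tuple determines $h$. Put $\overline\lambda:=\sup\{\lambda\mid(\lambda,z)\in\mathcal{C}\}$ and $M_\lambda:=\sup\{z\mid(\lambda,z)\in\mathcal{C}\}$. Let $\mathcal{U}$ be the set of those tuples $(\lambda,M_\lambda)\in\mathcal{C}$ whose function $h$ satisfies the usual conditions: $h>0$ and $h'>0$ on $(0,\infty)$, $\lim_{x\to0+}h(x)=0$ and $\lim_{x\to\infty}h(x)=\infty$. Define $$\gamma(x)=e^{-\int_\xi^x\frac{2k(s)}{\sigma^2(s)}ds},\quad Q(x)=\frac{2}{\sigma^2(x)\gamma(x)}\int_\xi^x\gamma(s)\,ds,\quad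 R(x)=\gamma(x)\int_\xi^x\frac{2}{\sigma^2(s)\gamma(s)}\,ds.$$ The endpoint $0$ is called inaccessible if $R\notin L^1(0,\xi)$, and an inaccessible endpoint $0$ is called natural if $Q\notin L^1(0,\xi)$; the same terms are used for the endpoint $\infty$ with $(\xi,\infty)$ in place of $(0,\xi)$. Assume that $0$ is natural, that $\infty$ is inaccessible, and that $\overline\lambda>r$. Then $\overline\lambda=\max\{\lambda\mid(\lambda,z)\in\mathcal{C}\}$, and $M_\lambda=\max\{z\mid(\lambda,z)\in\mathcal{C}\}$ for every $\lambda\le\overline\lambda$. Moreover: (a) If $\int_\xi^\infty\gamma(x)\,dx=\infty$, then $\mathcal{U}=\{(\lambda,M_\lambda)\mid\lambda\le\overline\lambda\}$ or $\mathcal{U}=\{(\lambda,M_\lambda)\mid\lambda<\overline\lambda\}$. If, in addition, $\infty$ is a natural boundary, then $\mathcal{U}=\{(\lambda,M_\lambda)\mid\lambda\le\overline\lambda\}$. (b) If $\int_\xi^\infty\gamma(x)\,dx<\infty$, then $\mathcal{U}=\{(\lambda,M_\lambda)\mid\lambda<r\}$. -/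

import Mathlib

open Set Filter Topology MeasureTheory

noncomputable section

namespace RepAgent

/-- The coefficients of the market: the state variable solves
`dX = b(X) dt + σ(X) dW`, `X₀ = ξ`, on `(0,∞)`; the numeraire has coefficients `r` and `v`.
All functions matter on `(0,∞)` only. -/
structure Model where
  b : ℝ → ℝ
  σ : ℝ → ℝ
  v : ℝ → ℝ
  r : ℝ → ℝ
  ξ : ℝ
  b_smooth : ContDiffOn ℝ 1 b (Ioi 0)
  σ_smooth : ContDiffOn ℝ 1 σ (Ioi 0)
  v_smooth : ContDiffOn ℝ 1 v (Ioi 0)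
  r_smooth : ContDiffOn ℝ 1 r (Ioi 0)
  σ_ne_zero : ∀ x, 0 < x → σ x ≠ 0
  ξ_pos : 0 < ξ

namespace Model

variable (m : Model)

/-- The drift `k = b - σ v` of the state variable under the measure with density
`exp(-½∫v² ds - ∫v dW)`. -/
def k (x : ℝ) : ℝ := m.b x - m.σ x * m.v x

/-- The operator `ℒ φ = ½ σ² φ'' + k φ' - r φ`. -/
def L (φ : ℝ → ℝ) (x : ℝ) : ℝ :=
  1 / 2 * m.σ x ^ 2 * deriv (deriv φ) x + m.k x * deriv φ x - m.r x * φ x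

/-- `(lam, h)` is a candidate pair: `h` is a positive `C²` solution of `ℒ h = -lam h` on `(0,∞)`
with `h(ξ) = 1`. -/
structure IsCandidatePair (lam : ℝ) (h : ℝ → ℝ) : Prop where
  smooth : ContDiffOn ℝ 2 h (Ioi 0)
  eigen : ∀ x, 0 < x → m.L h x = -lam * h x
  pos : ∀ x, 0 < x → 0 < h x
  normalized : h m.ξ = 1

/-- The set `𝒞` of candidate tuples `(lam, h'(ξ))`. -/
def candidates : Set (ℝ × ℝ) :=
  {p | ∃ h : ℝ → ℝ, m.IsCandidatePair p.1 h ∧ deriv h m.ξ = p.2}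

/-- The largest first coordinate `λ̄` of a candidate tuple. -/
def lamBar : ℝ := sSup {lam | ∃ z, (lam, z) ∈ m.candidates}

/-- `M_lam`, the largest `z` for which `(lam, z)` is a candidate tuple. -/
def M (lam : ℝ) : ℝ := sSup {z | (lam, z) ∈ m.candidates}

/-- The usual conditions on a function on `(0,∞)`. -/
structure UsualConditions (h : ℝ → ℝ) : Prop where
  pos : ∀ x, 0 < x → 0 < h x
  deriv_pos : ∀ x, 0 < x → 0 < deriv h x
  tendsto_zero : Tendsto h (𝓝[>] 0) (𝓝 0)
  tendsto_top : Tendsto h atTop atTop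

/-- The usual set `𝒰`: the candidate tuples `(lam, M_lam)` whose function satisfies the usual
conditions. The tuple determines its function on `(0,∞)`. -/
def usualSet : Set (ℝ × ℝ) :=
  {p | p.2 = m.M p.1 ∧
    ∃ h : ℝ → ℝ, m.IsCandidatePair p.1 h ∧ deriv h m.ξ = p.2 ∧ UsualConditions h}

/-- The density of the scale function. -/
def γ (x : ℝ) : ℝ := Real.exp (-∫ s in m.ξ..x, 2 * m.k s / m.σ s ^ 2)

/-- Feller's function `Q`. -/
def Q (x : ℝ) : ℝ := 2 / (m.σ x ^ 2 * m.γ x) * ∫ s in m.ξ..x, m.γ s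

/-- Feller's function `R`. -/
def R (x : ℝ) : ℝ := m.γ x * ∫ s in m.ξ..x, 2 / (m.σ s ^ 2 * m.γ s)

/-- The endpoint `0` is inaccessible. -/
def InaccessibleZero : Prop := ¬ IntegrableOn m.R (Ioo 0 m.ξ)

/-- The endpoint `∞` is inaccessible. -/
def InaccessibleTop : Prop := ¬ IntegrableOn m.R (Ioi m.ξ)

/-- The endpoint `0` is a natural boundary. -/
def NaturalZero : Prop := m.InaccessibleZero ∧ ¬ IntegrableOn m.Q (Ioo 0 m.ξ)

/-- The endpoint `∞` is a natural boundary. -/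
def NaturalTop : Prop := m.InaccessibleTop ∧ ¬ IntegrableOn m.Q (Ioi m.ξ)

end Model

end RepAgent

end

/-! Put `c = lam - r` and `p = h' / γ`, and let `w` be the speed density. The eigenvalue equation
becomes `p' = -c w h`, so everything depends on the sign of `c`.

Attainment: the solution with `h ξ = 1` and `p ξ = z` is affine in `z` and continuous in `c`. Being
positive amounts to a family of weak inequalities, so the admissible slopes form a compact set,
which shrinks as `c` grows (`Coef.posSlope_mono`). With the bound on `c` from
`Coef.bddAbove_posSlope`, both suprema are attained.

The main tool is `PosSol.not_bounded_of_max`: for the largest slope, `∫₀ γ / h² = ∞`. Each unwanted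
behaviour near `0` is refuted by exhibiting a function bounded below whose derivative dominates `γ /
h²`.

For `c < 0`, `p` is increasing and the tool makes it positive; the Feller conditions on `Q` at `0`
and on `R` at `∞` then give the two limits.

For `c ≥ 0`, `h` is concave as a function of the scale `S = ∫ γ`. If `S` is bounded at `∞`, so is
`h`, which excludes these `c`. If `S` is unbounded, concavity gives `p ≥ 0`. A solution at `λ̄`,
where `c > 0`, shows that `S` is bounded below at `0`, and the tool then gives `h → 0`. Below `λ̄`,
comparing Wronskians with that solution makes `h` grow at least like `log S`; at `λ̄` itself this
comparison is lost and naturality of `∞` replaces it. -/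

namespace RepAgent

open scoped Interval

/-! ### Comparison of derivatives and integrability criteria on the half-line. -/

section Calculus

theorem le_of_hasDerivAt_nonneg {f f' : ℝ → ℝ} {a b : ℝ} (hab : a ≤ b)
    (hf : ∀ x ∈ Icc a b, HasDerivAt f (f' x) x) (h0 : ∀ x ∈ Icc a b, 0 ≤ f' x) : f a ≤ f b := by
  refine monotoneOn_of_deriv_nonneg (convex_Icc a b)
    (fun x hx => (hf x hx).continuousAt.continuousWithinAt)
    (fun x hx => (hf x (interior_subset hx)).differentiableAt.differentiableWithinAt)
    (fun x hx => ?_) (left_mem_Icc.2 hab) (right_mem_Icc.2 hab) hab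
  rw [(hf x (interior_subset hx)).deriv]
  exact h0 x (interior_subset hx)

theorem lt_of_hasDerivAt_pos {f f' : ℝ → ℝ} {a b : ℝ} (hab : a < b)
    (hf : ∀ x ∈ Icc a b, HasDerivAt f (f' x) x) (h0 : ∀ x ∈ Icc a b, 0 < f' x) : f a < f b := by
  refine strictMonoOn_of_deriv_pos (convex_Icc a b)
    (fun x hx => (hf x hx).continuousAt.continuousWithinAt)
    (fun x hx => ?_) (left_mem_Icc.2 hab.le) (right_mem_Icc.2 hab.le) hab
  rw [(hf x (interior_subset hx)).deriv]
  exact h0 x (interior_subset hx)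

theorem sub_le_sub_of_hasDerivAt_le {f f' g g' : ℝ → ℝ} {a b : ℝ} (hab : a ≤ b)
    (hf : ∀ x ∈ Icc a b, HasDerivAt f (f' x) x) (hg : ∀ x ∈ Icc a b, HasDerivAt g (g' x) x)
    (h : ∀ x ∈ Icc a b, f' x ≤ g' x) : f b - f a ≤ g b - g a := by
  have := le_of_hasDerivAt_nonneg (f := fun x => g x - f x) hab
    (fun x hx => (hg x hx).sub (hf x hx)) (fun x hx => sub_nonneg.2 (h x hx))
  linarith

theorem uIcc_subset_Ioi {a b : ℝ} (ha : 0 < a) (hb : 0 < b) : uIcc a b ⊆ Ioi 0 :=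
  (convex_Ioi (0 : ℝ)).ordConnected.uIcc_subset ha hb

theorem intervalIntegrable_of_continuousOn_Ioi {f : ℝ → ℝ} (hf : ContinuousOn f (Ioi 0)) {a b : ℝ}
    (ha : 0 < a) (hb : 0 < b) : IntervalIntegrable f volume a b :=
  (hf.mono (uIcc_subset_Ioi ha hb)).intervalIntegrable

theorem hasDerivAt_primitive {f : ℝ → ℝ} (hf : ContinuousOn f (Ioi 0)) {a x : ℝ}
    (ha : 0 < a) (hx : 0 < x) : HasDerivAt (fun x => ∫ s in a..x, f s) (f x) x :=
  intervalIntegral.integral_hasDerivAt_right (intervalIntegrable_of_continuousOn_Ioi hf ha hx)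
    (hf.stronglyMeasurableAtFilter isOpen_Ioi x hx) (hf.continuousAt (Ioi_mem_nhds hx))

theorem continuousOn_primitive {f : ℝ → ℝ} (hf : ContinuousOn f (Ioi 0)) {a : ℝ}
    (ha : 0 < a) : ContinuousOn (fun x => ∫ s in a..x, f s) (Ioi 0) :=
  fun _ hx => (hasDerivAt_primitive hf ha hx).continuousAt.continuousWithinAt

/-- Read contrapositively, this criterion and its analogue at `∞` turn each Feller condition into a
contradiction: an explicit one-sidedly bounded `F` would make `Q` or `R` integrable. -/
theorem integrableOn_Ioo_of_abs_le_deriv {f F F' : ℝ → ℝ} {b C : ℝ} (hb : 0 < b)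
    (hf : ContinuousOn f (Ioi 0)) (hF : ∀ x ∈ Ioc 0 b, HasDerivAt F (F' x) x)
    (hle : ∀ x ∈ Ioc 0 b, |f x| ≤ F' x) (hC : ∀ x ∈ Ioc 0 b, C ≤ F x) :
    IntegrableOn f (Ioo 0 b) := by
  have hsub : Tendsto (fun n : ℕ => b / (n + 1)) atTop (𝓝 0) :=
    tendsto_const_div_atTop_nhds_zero_nat b |>.comp (tendsto_add_atTop_nat 1) |>.congr
      (fun n => by simp)
  have hpos : ∀ n : ℕ, 0 < b / (n + 1) := fun n => by positivity
  have hle' : ∀ n : ℕ, b / (n + 1) ≤ b := fun n =>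
    div_le_self hb.le (by linarith [Nat.cast_nonneg (α := ℝ) n])
  have := integrableOn_Ioc_of_intervalIntegral_norm_bounded_left (f := f) (b := b) (I := F b - C)
    (fun n => ((intervalIntegrable_of_continuousOn_Ioi hf (hpos n) hb).1)) hsub
    (Eventually.of_forall fun n => ?_)
  · exact this.mono_set Ioo_subset_Ioc_self
  · have h1 := sub_le_sub_of_hasDerivAt_le (hle' n)
      (fun x hx => hasDerivAt_primitive (f := fun x => ‖f x‖) hf.norm hb
        ((hpos n).trans_le hx.1))
      (fun x hx => hF x ⟨(hpos n).trans_le hx.1, hx.2⟩)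
      (fun x hx => hle x ⟨(hpos n).trans_le hx.1, hx.2⟩)
    have h2 := hC _ ⟨hpos n, hle' n⟩
    rw [← intervalIntegral.integral_of_le (hle' n), intervalIntegral.integral_symm]
    simp only [intervalIntegral.integral_same] at h1
    linarith

theorem integrableOn_Ioi_of_abs_le_deriv {f F F' : ℝ → ℝ} {a C : ℝ} (ha : 0 < a)
    (hf : ContinuousOn f (Ioi 0)) (hF : ∀ x, a ≤ x → HasDerivAt F (F' x) x)
    (hle : ∀ x, a ≤ x → |f x| ≤ F' x) (hC : ∀ x, a ≤ x → F x ≤ C) :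
    IntegrableOn f (Ioi a) := by
  refine integrableOn_Ioi_of_intervalIntegral_norm_bounded (b := fun n : ℕ => a + n) (C - F a) a
    (fun n => (intervalIntegrable_of_continuousOn_Ioi hf ha (by positivity)).1)
    (tendsto_atTop_add_const_left _ _ tendsto_natCast_atTop_atTop)
    (Eventually.of_forall fun n => ?_)
  have hn : a ≤ a + n := by simp
  have h1 := sub_le_sub_of_hasDerivAt_le hn
    (fun x hx => hasDerivAt_primitive (f := fun x => ‖f x‖) hf.norm ha (ha.trans_le hx.1))
    (fun x hx => hF x hx.1) (fun x hx => hle x hx.1)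
  have h2 := hC _ hn
  simp only [intervalIntegral.integral_same] at h1
  linarith

theorem pos_of_ne_zero_of_pos {f : ℝ → ℝ} (hf : ContinuousOn f (Ioi 0))
    (h0 : ∀ x, 0 < x → f x ≠ 0) {a : ℝ} (ha : 0 < a) (hfa : 0 < f a) {x : ℝ} (hx : 0 < x) :
    0 < f x := by
  by_contra hneg
  obtain ⟨y, hy, hy0⟩ := isPreconnected_Ioi.intermediate_value (mem_Ioi.2 hx) (mem_Ioi.2 ha) hf
    (⟨not_lt.1 hneg, hfa.le⟩ : (0 : ℝ) ∈ Icc (f x) (f a))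
  exact h0 y hy hy0

theorem tendsto_nhdsGT_zero_of_monotoneOn {f : ℝ → ℝ} (hf : MonotoneOn f (Ioi 0))
    (hpos : ∀ x, 0 < x → 0 < f x) (h : ∀ ε > 0, ∃ x, 0 < x ∧ f x < ε) :
    Tendsto f (𝓝[>] 0) (𝓝 0) := by
  rw [Metric.tendsto_nhds]
  intro ε hε
  obtain ⟨x, hx, hfx⟩ := h ε hε
  filter_upwards [Ioo_mem_nhdsGT hx] with y hy
  rw [Real.dist_eq, sub_zero, abs_of_pos (hpos y hy.1)]
  exact (hf hy.1 hx hy.2.le).trans_lt hfx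

theorem tendsto_atTop_of_monotoneOn {f : ℝ → ℝ} (hf : MonotoneOn f (Ioi 0))
    (h : ∀ C, ∃ x, 0 < x ∧ C < f x) : Tendsto f atTop atTop := by
  rw [tendsto_atTop]
  intro C
  obtain ⟨x, hx, hfx⟩ := h C
  filter_upwards [eventually_ge_atTop x] with y hy
  exact hfx.le.trans (hf hx (mem_Ioi.2 (lt_of_lt_of_le hx hy)) hy)

end Calculus

/-! ### Neumann series for the integral form of the equation. -/

section Volterra

/-- The iterated integral operator whose Neumann series solves the equation
`(h' / γ)' = -c w h`. -/
noncomputable def volterra (γ w : ℝ → ℝ) (ξ : ℝ) (f : ℝ → ℝ) (x : ℝ) : ℝ :=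
  ∫ t in ξ..x, γ t * ∫ s in ξ..t, w s * f s

variable {γ w : ℝ → ℝ} {ξ : ℝ}

theorem continuousOn_volterra (hγ : ContinuousOn γ (Ioi 0)) (hw : ContinuousOn w (Ioi 0))
    (hξ : 0 < ξ) {f : ℝ → ℝ} (hf : ContinuousOn f (Ioi 0)) :
    ContinuousOn (volterra γ w ξ f) (Ioi 0) :=
  continuousOn_primitive (hγ.mul (continuousOn_primitive (hw.mul hf) hξ)) hξ

theorem continuousOn_volterra_iterate (hγ : ContinuousOn γ (Ioi 0)) (hw : ContinuousOn w (Ioi 0))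
    (hξ : 0 < ξ) {f : ℝ → ℝ} (hf : ContinuousOn f (Ioi 0)) (n : ℕ) :
    ContinuousOn ((volterra γ w ξ)^[n] f) (Ioi 0) := by
  induction n with
  | zero => exact hf
  | succ n ih =>
    rw [Function.iterate_succ_apply']
    exact continuousOn_volterra hγ hw hξ ih

/-- The outer integration of `|t - ξ| ^ n` supplies the factor `1 / (n + 1)`; iterating it produces
the factorial that makes the series converge for every `c`. -/
theorem abs_volterra_le (hγ : ContinuousOn γ (Ioi 0)) (hw : ContinuousOn w (Ioi 0))
    {a b G H K : ℝ} (ha : 0 < a) (hξ : ξ ∈ Icc a b)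
    (hG : ∀ x ∈ Icc a b, |γ x| ≤ G) (hH : ∀ x ∈ Icc a b, |w x| ≤ H) {f : ℝ → ℝ}
    (hf : ContinuousOn f (Ioi 0)) {n : ℕ} (hK : 0 ≤ K)
    (hfK : ∀ x ∈ Icc a b, |f x| ≤ K * |x - ξ| ^ n) {x : ℝ} (hx : x ∈ Icc a b) :
    |volterra γ w ξ f x| ≤ G * (H * (b - a)) * K * (|x - ξ| ^ (n + 1) / (n + 1)) := by
  have hξ0 : 0 < ξ := ha.trans_le hξ.1
  have hG0 : 0 ≤ G := (abs_nonneg _).trans (hG ξ hξ)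
  have hH0 : 0 ≤ H := (abs_nonneg _).trans (hH ξ hξ)
  have hsub : ∀ {t}, t ∈ Icc a b → Ι ξ t ⊆ Icc a b := fun {t} ht =>
    uIoc_subset_uIcc.trans (ordConnected_Icc.uIcc_subset hξ ht)
  have inner : ∀ t ∈ Icc a b, |∫ s in ξ..t, w s * f s| ≤ H * (b - a) * K * |t - ξ| ^ n := by
    intro t ht
    have h1 := intervalIntegral.norm_integral_le_of_norm_le_const (a := ξ) (b := t)
      (f := fun s => w s * f s) (C := H * (K * |t - ξ| ^ n)) (fun s hs => by
        have hs' := hsub ht hs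
        rw [norm_mul, Real.norm_eq_abs, Real.norm_eq_abs]
        have h3 : |s - ξ| ≤ |t - ξ| := by
          exact abs_sub_left_of_mem_uIcc (uIoc_subset_uIcc hs)
        have h2 : |f s| ≤ K * |t - ξ| ^ n := (hfK s hs').trans (by gcongr)
        exact mul_le_mul (hH s hs') h2 (abs_nonneg _) hH0)
    have h4 : |t - ξ| ≤ b - a := abs_sub_le_of_le_of_le ht.1 ht.2 hξ.1 hξ.2
    calc |∫ s in ξ..t, w s * f s| ≤ H * (K * |t - ξ| ^ n) * |t - ξ| := h1
      _ ≤ H * (K * |t - ξ| ^ n) * (b - a) := by gcongr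
      _ = _ := by ring
  have hx0 : 0 < x := ha.trans_le hx.1
  have hc : ContinuousOn (fun t => γ t * ∫ s in ξ..t, w s * f s) (Ioi 0) :=
    hγ.mul (continuousOn_primitive (hw.mul hf) hξ0)
  calc |volterra γ w ξ f x| ≤ ∫ t in Ι ξ x, ‖γ t * ∫ s in ξ..t, w s * f s‖ :=
        intervalIntegral.norm_integral_le_integral_norm_uIoc
          (f := fun t => γ t * ∫ s in ξ..t, w s * f s)
    _ ≤ ∫ t in Ι ξ x, G * (H * (b - a)) * K * |t - ξ| ^ n := by
        refine setIntegral_mono_on ?_ ?_ measurableSet_uIoc fun t ht => ?_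
        · exact intervalIntegrable_iff.1 (intervalIntegrable_of_continuousOn_Ioi hc hξ0 hx0).norm
        · exact intervalIntegrable_iff.1 (Continuous.intervalIntegrable (by fun_prop) _ _)
        · have ht' := hsub hx ht
          rw [norm_mul, Real.norm_eq_abs, Real.norm_eq_abs]
          calc _ ≤ G * (H * (b - a) * K * |t - ξ| ^ n) :=
                mul_le_mul (hG t ht') (inner t ht') (abs_nonneg _) hG0
            _ = _ := by ring
    _ = _ := by rw [integral_const_mul, integral_pow_abs_sub_uIoc]

theorem exists_abs_volterra_iterate_le (hγ : ContinuousOn γ (Ioi 0)) (hw : ContinuousOn w (Ioi 0))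
    {f : ℝ → ℝ} (hf : ContinuousOn f (Ioi 0)) {a b : ℝ} (ha : 0 < a) (hξ : ξ ∈ Icc a b) :
    ∃ A B : ℝ, 0 ≤ A ∧ 0 ≤ B ∧
      ∀ n : ℕ, ∀ x ∈ Icc a b, |(volterra γ w ξ)^[n] f x| ≤ B * (A ^ n / n.factorial) := by
  have hsub : Icc a b ⊆ Ioi 0 := fun x hx => ha.trans_le hx.1
  have hξ0 : 0 < ξ := ha.trans_le hξ.1
  obtain ⟨G, hG⟩ := isCompact_Icc.exists_bound_of_continuousOn (hγ.mono hsub)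
  obtain ⟨H, hH⟩ := isCompact_Icc.exists_bound_of_continuousOn (hw.mono hsub)
  obtain ⟨B, hB⟩ := isCompact_Icc.exists_bound_of_continuousOn (hf.mono hsub)
  have hG0 : 0 ≤ G := (norm_nonneg _).trans (hG ξ hξ)
  have hH0 : 0 ≤ H := (norm_nonneg _).trans (hH ξ hξ)
  have hB0 : 0 ≤ B := (norm_nonneg _).trans (hB ξ hξ)
  have hab : 0 ≤ b - a := by linarith [hξ.1, hξ.2]
  obtain ⟨D, hD⟩ : ∃ D, D = G * (H * (b - a)) := ⟨_, rfl⟩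
  have hD0 : 0 ≤ D := by rw [hD]; positivity
  have key : ∀ n : ℕ, ∀ x ∈ Icc a b,
      |(volterra γ w ξ)^[n] f x| ≤ B * (D ^ n / n.factorial) * |x - ξ| ^ n := by
    intro n
    induction n with
    | zero => intro x hx; simpa using hB x hx
    | succ n ih =>
      intro x hx
      rw [Function.iterate_succ_apply']
      refine (abs_volterra_le hγ hw ha hξ hG hH (continuousOn_volterra_iterate hγ hw hξ0 hf n)
        (by positivity) ih hx).trans_eq ?_
      rw [Nat.factorial_succ, ← hD]
      push_cast
      rw [pow_succ D]
      field_simp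
  refine ⟨D * (b - a), B, by positivity, hB0, fun n x hx => (key n x hx).trans ?_⟩
  have h4 : |x - ξ| ≤ b - a := abs_sub_le_of_le_of_le hx.1 hx.2 hξ.1 hξ.2
  calc B * (D ^ n / n.factorial) * |x - ξ| ^ n ≤ B * (D ^ n / n.factorial) * (b - a) ^ n := by
        gcongr
    _ = _ := by rw [mul_pow]; ring

/-- The Neumann series of the Volterra operator. -/
noncomputable def neumann (γ w : ℝ → ℝ) (ξ : ℝ) (f : ℝ → ℝ) (c x : ℝ) : ℝ :=
  ∑' n : ℕ, (-c) ^ n * (volterra γ w ξ)^[n] f x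

theorem exists_summable_bound (hγ : ContinuousOn γ (Ioi 0)) (hw : ContinuousOn w (Ioi 0))
    {f : ℝ → ℝ} (hf : ContinuousOn f (Ioi 0)) {a b : ℝ} (ha : 0 < a) (hξ : ξ ∈ Icc a b)
    (ρ : ℝ) : ∃ u : ℕ → ℝ, Summable u ∧
      ∀ n : ℕ, ∀ c, |c| ≤ ρ → ∀ x ∈ Icc a b, |(-c) ^ n * (volterra γ w ξ)^[n] f x| ≤ u n := by
  obtain ⟨A, B, hA, hB, h⟩ := exists_abs_volterra_iterate_le hγ hw hf ha hξ
  refine ⟨fun n => B * ((ρ * A) ^ n / n.factorial),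
    (Real.summable_pow_div_factorial _).mul_left B, fun n c hc x hx => ?_⟩
  rw [abs_mul, abs_pow, abs_neg]
  have hρ : 0 ≤ ρ := (abs_nonneg c).trans hc
  calc |c| ^ n * |(volterra γ w ξ)^[n] f x| ≤ ρ ^ n * (B * (A ^ n / n.factorial)) := by
        gcongr
        exact h n x hx
    _ = _ := by simp only [mul_pow]; ring

theorem exists_Icc_of_pos {x y : ℝ} (hx : 0 < x) (hy : 0 < y) :
    ∃ a b : ℝ, 0 < a ∧ x ∈ Ioo a b ∧ y ∈ Ioo a b :=
  ⟨min x y / 2, max x y + 1, by positivity,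
    ⟨by linarith [min_le_left x y, lt_min hx hy], by linarith [le_max_left x y]⟩,
    ⟨by linarith [min_le_right x y, lt_min hx hy], by linarith [le_max_right x y]⟩⟩

theorem continuousOn_neumann (hγ : ContinuousOn γ (Ioi 0)) (hw : ContinuousOn w (Ioi 0))
    (hξ : 0 < ξ) {f : ℝ → ℝ} (hf : ContinuousOn f (Ioi 0)) (c : ℝ) :
    ContinuousOn (neumann γ w ξ f c) (Ioi 0) := by
  intro x hx
  obtain ⟨a, b, ha, hξ', hx'⟩ := exists_Icc_of_pos hξ hx
  obtain ⟨u, hu, hb⟩ := exists_summable_bound hγ hw hf ha (Ioo_subset_Icc_self hξ') |c|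
  have := continuousOn_tsum (f := fun n x => (-c) ^ n * (volterra γ w ξ)^[n] f x)
    (s := Icc a b) (fun n => continuousOn_const.mul
      ((continuousOn_volterra_iterate hγ hw hξ hf n).mono fun y hy => ha.trans_le hy.1)) hu
    (fun n y hy => hb n c le_rfl y hy)
  exact (this.continuousAt (Icc_mem_nhds hx'.1 hx'.2)).continuousWithinAt

theorem continuous_neumann_param (hγ : ContinuousOn γ (Ioi 0)) (hw : ContinuousOn w (Ioi 0))
    (hξ : 0 < ξ) {f : ℝ → ℝ} (hf : ContinuousOn f (Ioi 0)) {x : ℝ} (hx : 0 < x) :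
    Continuous fun c => neumann γ w ξ f c x := by
  rw [continuous_iff_continuousAt]
  intro c
  obtain ⟨a, b, ha, hξ', hx'⟩ := exists_Icc_of_pos hξ hx
  obtain ⟨u, hu, hb⟩ := exists_summable_bound hγ hw hf ha (Ioo_subset_Icc_self hξ') (|c| + 1)
  have := continuousOn_tsum (f := fun n c => (-c) ^ n * (volterra γ w ξ)^[n] f x)
    (s := Metric.ball c 1) (fun n => by fun_prop) hu (fun n y hy => hb n y (by
      have h1 : |y - c| < 1 := hy
      linarith [abs_sub_abs_le_abs_sub y c]) x (Ioo_subset_Icc_self hx'))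
  exact this.continuousAt (Metric.ball_mem_nhds c one_pos)

/-- The operator is moved through the series by dominated convergence, once for each integral; this
shifts the index by one and leaves out the term `f`. -/
theorem neumann_eq (hγ : ContinuousOn γ (Ioi 0)) (hw : ContinuousOn w (Ioi 0))
    (hξ : 0 < ξ) {f : ℝ → ℝ} (hf : ContinuousOn f (Ioi 0)) (c : ℝ) {x : ℝ} (hx : 0 < x) :
    neumann γ w ξ f c x = f x - c * volterra γ w ξ (neumann γ w ξ f c) x := by
  obtain ⟨a, b, ha, hξ', hx'⟩ := exists_Icc_of_pos hξ hx
  replace hξ' := Ioo_subset_Icc_self hξ'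
  replace hx' := Ioo_subset_Icc_self hx'
  obtain ⟨u, hu, hb⟩ := exists_summable_bound hγ hw hf ha hξ' |c|
  have hsum : ∀ y ∈ Icc a b, Summable fun n => (-c) ^ n * (volterra γ w ξ)^[n] f y :=
    fun y hy => Summable.of_norm_bounded hu fun n => hb n c le_rfl y hy
  have hsub : Icc a b ⊆ Ioi 0 := fun x hx => ha.trans_le hx.1
  have hsub' : ∀ {t}, t ∈ Icc a b → Ι ξ t ⊆ Icc a b := fun {t} ht =>
    uIoc_subset_uIcc.trans (ordConnected_Icc.uIcc_subset hξ' ht)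
  obtain ⟨G, hG⟩ := isCompact_Icc.exists_bound_of_continuousOn (hγ.mono hsub)
  obtain ⟨H, hH⟩ := isCompact_Icc.exists_bound_of_continuousOn (hw.mono hsub)
  have hH0 : 0 ≤ H := (norm_nonneg _).trans (hH ξ hξ')
  have hG0 : 0 ≤ G := (norm_nonneg _).trans (hG ξ hξ')
  have hu0 : ∀ n, 0 ≤ u n := fun n => (abs_nonneg _).trans (hb n c le_rfl ξ hξ')
  have hci := fun n => continuousOn_volterra_iterate hγ hw hξ hf n
  have h1 : ∀ t ∈ Icc a b, HasSum (fun n => ∫ s in ξ..t, w s * ((-c) ^ n * (volterra γ w ξ)^[n] f s))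
      (∫ s in ξ..t, w s * neumann γ w ξ f c s) := by
    intro t ht
    refine intervalIntegral.hasSum_integral_of_dominated_convergence (fun n _ => H * u n)
      (fun n => ?_) (fun n => Eventually.of_forall fun s hs => ?_)
      (Eventually.of_forall fun _ _ => hu.mul_left H) (by simp)
      (Eventually.of_forall fun s hs => ((hsum s (hsub' ht hs)).hasSum.mul_left (w s)))
    · exact ((hw.mul (continuousOn_const.mul (hci n))).mono
        ((hsub' ht).trans hsub)).aestronglyMeasurable measurableSet_uIoc
    · rw [norm_mul]
      exact mul_le_mul (hH s (hsub' ht hs)) (hb n c le_rfl s (hsub' ht hs)) (norm_nonneg _) hH0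
  have h2 : HasSum (fun n => ∫ t in ξ..x, γ t *
      ∫ s in ξ..t, w s * ((-c) ^ n * (volterra γ w ξ)^[n] f s))
      (volterra γ w ξ (neumann γ w ξ f c) x) := by
    refine intervalIntegral.hasSum_integral_of_dominated_convergence
      (fun n _ => G * (H * u n * (b - a)))
      (fun n => ?_) (fun n => Eventually.of_forall fun t ht => ?_)
      (Eventually.of_forall fun _ _ => ((hu.mul_left H).mul_right (b - a)).mul_left G) (by simp)
      (Eventually.of_forall fun t ht => (h1 t (hsub' hx' ht)).mul_left (γ t))
    · exact ((hγ.mul (continuousOn_primitive (hw.mul (continuousOn_const.mul (hci n))) hξ)).mono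
        ((hsub' hx').trans hsub)).aestronglyMeasurable measurableSet_uIoc
    · have ht' := hsub' hx' ht
      rw [norm_mul]
      refine mul_le_mul (hG t ht') ?_ (norm_nonneg _) hG0
      have h3 := intervalIntegral.norm_integral_le_of_norm_le_const (a := ξ) (b := t)
        (f := fun s => w s * ((-c) ^ n * (volterra γ w ξ)^[n] f s)) (C := H * u n)
        (fun s hs => by
          rw [norm_mul]
          exact mul_le_mul (hH s (hsub' ht' hs)) (hb n c le_rfl s (hsub' ht' hs))
            (norm_nonneg _) hH0)
      have h4 : |t - ξ| ≤ b - a := abs_sub_le_of_le_of_le ht'.1 ht'.2 hξ'.1 hξ'.2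
      exact h3.trans (mul_le_mul_of_nonneg_left h4 (mul_nonneg hH0 (hu0 n)))
  have h3 : ∀ n, (∫ t in ξ..x, γ t * ∫ s in ξ..t, w s * ((-c) ^ n * (volterra γ w ξ)^[n] f s))
      = (-c) ^ n * (volterra γ w ξ)^[n + 1] f x := by
    intro n
    rw [Function.iterate_succ_apply', volterra, ← intervalIntegral.integral_const_mul]
    refine intervalIntegral.integral_congr fun t _ => ?_
    rw [mul_left_comm ((-c) ^ n), ← intervalIntegral.integral_const_mul ((-c) ^ n)]
    congr 1
    exact intervalIntegral.integral_congr fun s _ => by ring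
  simp_rw [h3] at h2
  rw [neumann, (hsum x hx').tsum_eq_zero_add, ← h2.tsum_eq, ← tsum_mul_left]
  simp only [pow_zero, one_mul, Function.iterate_zero, id_eq, sub_eq_add_neg, ← tsum_neg]
  congr 2
  ext n
  ring

end Volterra

/-! ### Positive solutions and their slopes at the base point. -/

section Solutions

/-- `h` solves `(h' / γ)' = -c w h` on `(0,∞)`, and `p = h' / γ`. -/
structure Sol (γ w : ℝ → ℝ) (c : ℝ) (h p : ℝ → ℝ) : Prop where
  dh : ∀ x, 0 < x → HasDerivAt h (γ x * p x) x
  dp : ∀ x, 0 < x → HasDerivAt p (-c * w x * h x) x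

/-- Continuous positive coefficients on `(0,∞)` and a base point. -/
structure Coef (γ w : ℝ → ℝ) (ξ : ℝ) : Prop where
  contγ : ContinuousOn γ (Ioi 0)
  contw : ContinuousOn w (Ioi 0)
  posγ : ∀ x, 0 < x → 0 < γ x
  posw : ∀ x, 0 < x → 0 < w x
  posξ : 0 < ξ

/-- A positive solution with value `1` and quasi-derivative `z` at `ξ`. -/
structure PosSol (γ w : ℝ → ℝ) (ξ c z : ℝ) (h p : ℝ → ℝ) : Prop extends Sol γ w c h p where
  val : h ξ = 1
  slope : p ξ = z
  pos : ∀ x, 0 < x → 0 < h x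

/-- `z` is the quasi-derivative at `ξ` of a normalized positive solution. -/
def PosSlope (γ w : ℝ → ℝ) (ξ c z : ℝ) : Prop := ∃ h p, PosSol γ w ξ c z h p

variable {γ w : ℝ → ℝ} {ξ : ℝ}

theorem Sol.continuousOn {c : ℝ} {h p : ℝ → ℝ} (H : Sol γ w c h p) : ContinuousOn h (Ioi 0) :=
  fun x hx => (H.dh x hx).continuousAt.continuousWithinAt

theorem Sol.continuousOn_deriv {c : ℝ} {h p : ℝ → ℝ} (H : Sol γ w c h p) :
    ContinuousOn p (Ioi 0) :=
  fun x hx => (H.dp x hx).continuousAt.continuousWithinAt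

theorem Sol.hasDerivAt_wronskian {c c' : ℝ} {h p g q : ℝ → ℝ} (H : Sol γ w c h p)
    (G : Sol γ w c' g q) {x : ℝ} (hx : 0 < x) :
    HasDerivAt (fun x => p x * g x - h x * q x) ((c' - c) * w x * (h x * g x)) x := by
  exact (((H.dp x hx).mul (G.dh x hx)).sub ((H.dh x hx).mul (G.dp x hx))).congr_deriv (by ring)

theorem Sol.wronskian_eq {c : ℝ} {h p g q : ℝ → ℝ} (H : Sol γ w c h p) (G : Sol γ w c g q)
    {x y : ℝ} (hx : 0 < x) (hy : 0 < y) :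
    p x * g x - h x * q x = p y * g y - h y * q y := by
  have hd : ∀ t ∈ Ioi (0 : ℝ), HasDerivAt (fun x => p x * g x - h x * q x) 0 t := fun t ht => by
    simpa using H.hasDerivAt_wronskian G ht
  exact isOpen_Ioi.is_const_of_deriv_eq_zero isPreconnected_Ioi
    (fun t ht => (hd t ht).differentiableAt.differentiableWithinAt)
    (fun t ht => (hd t ht).deriv) hx hy

theorem Sol.lin {c : ℝ} {h p g q : ℝ → ℝ} (H : Sol γ w c h p) (G : Sol γ w c g q) (α β : ℝ) :
    Sol γ w c (fun x => α * h x + β * g x) (fun x => α * p x + β * q x) where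
  dh x hx := by
    exact (((H.dh x hx).const_mul α).add ((G.dh x hx).const_mul β)).congr_deriv (by ring)
  dp x hx := by
    exact (((H.dp x hx).const_mul α).add ((G.dp x hx).const_mul β)).congr_deriv (by ring)

theorem Coef.hasDerivAt_scale (C : Coef γ w ξ) {x : ℝ} (hx : 0 < x) :
    HasDerivAt (fun x => ∫ s in ξ..x, γ s) (γ x) x :=
  hasDerivAt_primitive C.contγ C.posξ hx

theorem Coef.sol_neumann (C : Coef γ w ξ) {f : ℝ → ℝ} {β : ℝ}
    (hf : ∀ x, 0 < x → HasDerivAt f (γ x * β) x) (c : ℝ) :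
    Sol γ w c (neumann γ w ξ f c) (fun x => β - c * ∫ s in ξ..x, w s * neumann γ w ξ f c s) := by
  have hfc : ContinuousOn f (Ioi 0) := fun x hx => (hf x hx).continuousAt.continuousWithinAt
  have hN := continuousOn_neumann C.contγ C.contw C.posξ hfc c
  have hP := C.contw.mul hN
  refine ⟨fun x hx => ?_, fun x hx => ?_⟩
  · have h1 : neumann γ w ξ f c =ᶠ[𝓝 x] fun x => f x - c * volterra γ w ξ (neumann γ w ξ f c) x := by
      filter_upwards [Ioi_mem_nhds hx] with y hy
      exact neumann_eq C.contγ C.contw C.posξ hfc c hy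
    refine HasDerivAt.congr_of_eventuallyEq ?_ h1
    have h2 := hasDerivAt_primitive (C.contγ.mul (continuousOn_primitive hP C.posξ)) C.posξ hx
    exact ((hf x hx).sub (h2.const_mul c)).congr_deriv (by simp only [Pi.mul_apply]; ring)
  · exact (((hasDerivAt_primitive hP C.posξ hx).const_mul c).const_sub β).congr_deriv
      (by simp only [Pi.mul_apply]; ring)

theorem Coef.neumann_base (C : Coef γ w ξ) {f : ℝ → ℝ} (hf : ContinuousOn f (Ioi 0)) (c : ℝ) :
    neumann γ w ξ f c ξ = f ξ := by
  rw [neumann_eq C.contγ C.contw C.posξ hf c C.posξ]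
  simp [volterra]

theorem Coef.exists_fundamental (C : Coef γ w ξ) : ∃ y₁ p₁ y₂ p₂ : ℝ → ℝ → ℝ,
    (∀ c, Sol γ w c (y₁ c) (p₁ c)) ∧ (∀ c, Sol γ w c (y₂ c) (p₂ c)) ∧
    (∀ c, y₁ c ξ = 1 ∧ p₁ c ξ = 0 ∧ y₂ c ξ = 0 ∧ p₂ c ξ = 1) ∧
    ∀ x, 0 < x → Continuous (fun c => y₁ c x) ∧ Continuous (fun c => y₂ c x) := by
  have hS := continuousOn_primitive C.contγ C.posξ
  refine ⟨neumann γ w ξ fun _ => 1, _, neumann γ w ξ fun x => ∫ s in ξ..x, γ s, _,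
    C.sol_neumann (β := 0) fun x hx => by simpa using hasDerivAt_const x (1 : ℝ),
    C.sol_neumann (β := 1) fun x hx => by simpa using C.hasDerivAt_scale hx,
    fun c => ⟨C.neumann_base continuousOn_const c, by simp, ?_, by simp⟩, fun x hx =>
      ⟨continuous_neumann_param C.contγ C.contw C.posξ continuousOn_const hx,
        continuous_neumann_param C.contγ C.contw C.posξ hS hx⟩⟩
  rw [C.neumann_base hS]
  simp

/-- Zero Cauchy data make the Wronskians of `h` with both fundamental solutions vanish, while these
two have Wronskian `-1`; Cramer's rule gives `h = 0`. -/
theorem Sol.eq_zero {c : ℝ} {h p : ℝ → ℝ} (C : Coef γ w ξ) (H : Sol γ w c h p) {x₀ : ℝ}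
    (hx₀ : 0 < x₀) (h0 : h x₀ = 0) (p0 : p x₀ = 0) {x : ℝ} (hx : 0 < x) : h x = 0 := by
  obtain ⟨y₁, p₁, y₂, p₂, H₁, H₂, hi, -⟩ := C.exists_fundamental
  have e1 := H.wronskian_eq (H₁ c) hx hx₀
  have e2 := H.wronskian_eq (H₂ c) hx hx₀
  have e3 := (H₁ c).wronskian_eq (H₂ c) hx C.posξ
  rw [h0, p0] at e1 e2
  obtain ⟨i1, i2, i3, i4⟩ := hi c
  rw [i1, i2, i3, i4] at e3
  linear_combination h x * e3 + y₂ c x * e1 - y₁ c x * e2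

/-- An interior zero would be a minimum, hence a zero of `p` too, and uniqueness would make `h`
vanish at `ξ`. Thus positivity is a closed condition. -/
theorem Sol.pos_of_nonneg {c : ℝ} {h p : ℝ → ℝ} (C : Coef γ w ξ) (H : Sol γ w c h p)
    (h1 : h ξ = 1) (h0 : ∀ x, 0 < x → 0 ≤ h x) {x : ℝ} (hx : 0 < x) : 0 < h x := by
  refine lt_of_le_of_ne (h0 x hx) fun he => ?_
  have hmin : IsLocalMin h x := by
    filter_upwards [Ioi_mem_nhds hx] with y hy
    rw [← he]
    exact h0 y hy
  have hp := hmin.hasDerivAt_eq_zero (H.dh x hx)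
  have hp0 : p x = 0 := (mul_eq_zero.1 hp).resolve_left (C.posγ x hx).ne'
  have := H.eq_zero C hx he.symm hp0 C.posξ
  linarith

/-- The normalized solution of slope `z` is `y₁ + z y₂`. Since `y₂` takes both signs, the
inequalities bound `z` from both sides. -/
theorem Coef.exists_posSlope_iff (C : Coef γ w ξ) : ∃ y₁ y₂ : ℝ → ℝ → ℝ,
    (∀ x, 0 < x → Continuous (fun c => y₁ c x) ∧ Continuous (fun c => y₂ c x)) ∧
    (∀ c z, PosSlope γ w ξ c z ↔ ∀ x, 0 < x → 0 ≤ y₁ c x + z * y₂ c x) ∧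
    ∀ c, (∃ a, 0 < a ∧ y₂ c a < 0) ∧ ∃ b, 0 < b ∧ 0 < y₂ c b := by
  obtain ⟨y₁, p₁, y₂, p₂, H₁, H₂, hi, hc⟩ := C.exists_fundamental
  refine ⟨y₁, y₂, hc, fun c z => ⟨?_, fun h => ?_⟩, fun c => ?_⟩
  · rintro ⟨h, p, H⟩ x hx
    obtain ⟨i1, i2, i3, i4⟩ := hi c
    have h0 := (H.toSol.lin ((H₁ c).lin (H₂ c) 1 z) 1 (-1)).eq_zero C C.posξ
      (by simp [H.val, i1, i3]) (by simp [H.slope, i2, i4]) hx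
    have h1 := H.pos x hx
    linarith
  · have HS := (H₁ c).lin (H₂ c) 1 z
    obtain ⟨i1, i2, i3, i4⟩ := hi c
    refine ⟨_, _, HS, by simp [i1, i3], by simp [i2, i4], fun x hx =>
      HS.pos_of_nonneg C (by simp [i1, i3]) (fun x hx => ?_) hx⟩
    simpa using h x hx
  · obtain ⟨i1, i2, i3, i4⟩ := hi c
    have hd := hasDerivAt_iff_tendsto_slope.1 ((H₂ c).dh ξ C.posξ)
    rw [i4, mul_one] at hd
    have he := hd.eventually (lt_mem_nhds (C.posγ ξ C.posξ))
    constructor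
    · obtain ⟨a, ha, ha1, ha2⟩ := ((he.filter_mono (nhdsLT_le_nhdsNE ξ)).and
        ((eventually_mem_nhdsWithin).and
          (eventually_nhdsWithin_of_eventually_nhds (lt_mem_nhds C.posξ)))).exists
      refine ⟨a, ha2, ?_⟩
      rw [slope_def_field, i3, sub_zero] at ha
      rcases div_pos_iff.1 ha with h | h
      · exact absurd h.2 (not_lt.2 (sub_neg.2 ha1).le)
      · exact h.1
    · obtain ⟨a, ha, ha1⟩ := ((he.filter_mono (nhdsGT_le_nhdsNE ξ)).and
        (eventually_mem_nhdsWithin)).exists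
      refine ⟨a, C.posξ.trans ha1, ?_⟩
      rw [slope_def_field, i3, sub_zero] at ha
      exact (div_pos_iff_of_pos_right (sub_pos.2 ha1)).1 ha

theorem Coef.isCompact_posSlope (C : Coef γ w ξ) (c : ℝ) :
    IsCompact {z | PosSlope γ w ξ c z} := by
  obtain ⟨y₁, y₂, -, hiff, hs⟩ := C.exists_posSlope_iff
  obtain ⟨⟨a, ha, ha'⟩, b, hb, hb'⟩ := hs c
  refine isCompact_Icc.of_isClosed_subset (s := Icc (-y₁ c b / y₂ c b) (-y₁ c a / y₂ c a))
    ?_ fun z hz => ?_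
  · simp_rw [hiff, ofPred_forall]
    exact isClosed_iInter fun x => isClosed_iInter fun _ =>
      isClosed_le continuous_const (by fun_prop)
  · have hz' := (hiff c z).1 hz
    constructor
    · rw [div_le_iff₀ hb']
      linarith [hz' b hb]
    · rw [le_div_iff_of_neg ha']
      linarith [hz' a ha]

theorem PosSol.continuousOn {c z : ℝ} {h p : ℝ → ℝ} (H : PosSol γ w ξ c z h p) :
    ContinuousOn h (Ioi 0) := H.toSol.continuousOn

/-- The derivative of a quotient of solutions in terms of the Wronskian. -/
theorem Sol.hasDerivAt_div {c c' : ℝ} {h p g q : ℝ → ℝ} (H : Sol γ w c h p)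
    (G : Sol γ w c' g q) {x : ℝ} (hx : 0 < x) (hg : g x ≠ 0) :
    HasDerivAt (fun x => h x / g x) (γ x * (p x * g x - h x * q x) / g x ^ 2) x := by
  exact ((H.dh x hx).div (G.dh x hx) hg).congr_deriv (by ring)

/-- Let `h` have the same data at `ξ` as `g`, `f = h / g` and `W` be their Wronskian. Then `(f W)' =
γ (W / g)² + (c' - c) w h² ≥ 0` and `f W` vanishes at `ξ`. As `(f²)'` has the sign of `f W`, `f²` is
smallest at `ξ`, where it is `1`; so `h` has no zero. -/
theorem Coef.posSlope_mono (C : Coef γ w ξ) {c c' z : ℝ} (hcc : c ≤ c')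
    (hz : PosSlope γ w ξ c' z) : PosSlope γ w ξ c z := by
  obtain ⟨g, q, G⟩ := hz
  obtain ⟨y₁, p₁, y₂, p₂, H₁, H₂, hi, -⟩ := C.exists_fundamental
  obtain ⟨i1, i2, i3, i4⟩ := hi c
  have H := (H₁ c).lin (H₂ c) 1 z
  set h := fun x => 1 * y₁ c x + z * y₂ c x
  set p := fun x => 1 * p₁ c x + z * p₂ c x
  have hh : h ξ = 1 := by simp [h, i1, i3]
  have hp : p ξ = z := by simp [p, i2, i4]
  have dW := fun x (hx : 0 < x) => H.hasDerivAt_wronskian G.toSol hx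
  have df := fun x (hx : 0 < x) => H.hasDerivAt_div G.toSol hx (G.pos x hx).ne'
  set W := fun x => p x * g x - h x * q x
  set f := fun x => h x / g x
  have hf1 : f ξ = 1 := by simp [f, hh, G.val]
  have hfW0 : f ξ * W ξ = 0 := by simp [W, hh, hp, G.val, G.slope]
  have dfW := fun x (hx : 0 < x) => (df x hx).mul (dW x hx)
  have dfW0 : ∀ x, 0 < x → 0 ≤ γ x * (p x * g x - h x * q x) / g x ^ 2 * W x +
      f x * ((c' - c) * w x * (h x * g x)) := by
    intro x hx
    have e : γ x * (p x * g x - h x * q x) / g x ^ 2 * W x +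
      f x * ((c' - c) * w x * (h x * g x)) =
        γ x * (W x / g x) ^ 2 + (c' - c) * w x * h x ^ 2 := by
      have := (G.pos x hx).ne'
      simp only [W, f]
      field_simp
    rw [e]
    have h1 := C.posγ x hx
    have h2 := C.posw x hx
    have h3 := sub_nonneg.2 hcc
    positivity
  have df2 : ∀ x, 0 < x → HasDerivAt (fun x => f x ^ 2) (2 * γ x / g x ^ 2 * (f x * W x)) x := by
    intro x hx
    exact ((df x hx).pow 2).congr_deriv (by simp only [W, f]; push_cast; ring)
  have hco : ∀ x, 0 < x → 0 ≤ 2 * γ x / g x ^ 2 := fun x hx => by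
    have h1 := C.posγ x hx
    positivity
  have hsq : ∀ x, 0 < x → 1 ≤ f x ^ 2 := by
    intro x hx
    rcases le_total ξ x with hx' | hx'
    · have := le_of_hasDerivAt_nonneg hx' (fun t ht => df2 t (C.posξ.trans_le ht.1))
        (fun t ht => mul_nonneg (hco t (C.posξ.trans_le ht.1)) (by
          rw [← hfW0]
          exact le_of_hasDerivAt_nonneg ht.1 (fun s hs => dfW s (C.posξ.trans_le hs.1))
            (fun s hs => dfW0 s (C.posξ.trans_le hs.1))))
      simpa [hf1] using this
    · have := le_of_hasDerivAt_nonneg (f := fun x => -f x ^ 2) hx'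
        (fun t ht => (df2 t (hx.trans_le ht.1)).neg)
        (fun t ht => by
          have h4 : f t * W t ≤ f ξ * W ξ :=
            le_of_hasDerivAt_nonneg ht.2 (fun s hs => dfW s (hx.trans_le (ht.1.trans hs.1)))
              (fun s hs => dfW0 s (hx.trans_le (ht.1.trans hs.1)))
          rw [hfW0] at h4
          exact neg_nonneg.2 (mul_nonpos_of_nonneg_of_nonpos (hco t (hx.trans_le ht.1)) h4))
      rw [hf1] at this
      linarith
  refine ⟨h, p, H, hh, hp, fun x hx =>
    pos_of_ne_zero_of_pos H.continuousOn (fun y hy h0 => ?_) C.posξ (by rw [hh]; exact one_pos) hx⟩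
  have := hsq y hy
  simp only [f, h0, zero_div] at this
  norm_num at this

/-- A Prüfer angle argument on `[ξ, ξ + 1]`: with `c = k²`, the angle `arctan (p / (k h))` decreases
at rate at least `m k`, where `m` bounds `γ` and `w` from below, yet it stays in an interval of
length `π`. -/
theorem Coef.bddAbove_posSlope (C : Coef γ w ξ) : BddAbove {c | ∃ z, PosSlope γ w ξ c z} := by
  have hsub : Icc ξ (ξ + 1) ⊆ Ioi 0 := fun x hx => C.posξ.trans_le hx.1
  have hmin : ∀ {f : ℝ → ℝ}, ContinuousOn f (Ioi 0) → (∀ x, 0 < x → 0 < f x) →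
      ∃ m, 0 < m ∧ ∀ x ∈ Icc ξ (ξ + 1), m ≤ f x := fun {f} hf hpos => by
    obtain ⟨x, hx, hm⟩ := isCompact_Icc.exists_isMinOn
      (nonempty_Icc.2 (by linarith : ξ ≤ ξ + 1)) (hf.mono hsub)
    exact ⟨f x, hpos x (hsub hx), fun y hy => hm hy⟩
  obtain ⟨G, hG, hGle⟩ := hmin C.contγ C.posγ
  obtain ⟨H, hH, hHle⟩ := hmin C.contw C.posw
  obtain ⟨m, hm, hmG, hmH⟩ : ∃ m, 0 < m ∧ m ≤ G ∧ m ≤ H :=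
    ⟨min G H, lt_min hG hH, min_le_left _ _, min_le_right _ _⟩
  refine ⟨(Real.pi / m) ^ 2, ?_⟩
  rintro c ⟨z, h, p, S⟩
  rcases le_or_gt c 0 with hc | hc
  · exact hc.trans (sq_nonneg _)
  obtain ⟨k, hk, rfl⟩ : ∃ k, 0 < k ∧ c = k ^ 2 := ⟨√c, Real.sqrt_pos.2 hc, (Real.sq_sqrt hc.le).symm⟩
  have hd : ∀ x ∈ Icc ξ (ξ + 1), HasDerivAt (fun x => -Real.arctan (p x / h x / k))
      (-(1 / (1 + (p x / h x / k) ^ 2) *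
        (((-k ^ 2 * w x * h x) * h x - p x * (γ x * p x)) / h x ^ 2 / k))) x := fun x hx =>
    ((((S.dp x (hsub hx)).div (S.dh x (hsub hx)) (S.pos x (hsub hx)).ne').div_const k).arctan).neg
  have hl : ∀ x ∈ Icc ξ (ξ + 1), HasDerivAt (fun x => m * k * x) (m * k) x := fun x hx => by
    simpa using (hasDerivAt_id x).const_mul (m * k)
  have hcmp := sub_le_sub_of_hasDerivAt_le (by linarith) hl hd fun x hx => by
    have hh := S.pos x (hsub hx)
    have e : -(1 / (1 + (p x / h x / k) ^ 2) *
        (((-k ^ 2 * w x * h x) * h x - p x * (γ x * p x)) / h x ^ 2 / k)) =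
        k * (w x * (k * h x) ^ 2 + γ x * p x ^ 2) / ((k * h x) ^ 2 + p x ^ 2) := by
      field_simp
      ring
    rw [e, le_div_iff₀ (by positivity)]
    have h1 : m * (k * h x) ^ 2 ≤ w x * (k * h x) ^ 2 :=
      mul_le_mul_of_nonneg_right (hmH.trans (hHle x hx)) (sq_nonneg _)
    have h2 : m * p x ^ 2 ≤ γ x * p x ^ 2 :=
      mul_le_mul_of_nonneg_right (hmG.trans (hGle x hx)) (sq_nonneg _)
    nlinarith
  have hmk : m * k ≤ Real.pi := by
    have h1 := Real.neg_pi_div_two_lt_arctan (p (ξ + 1) / h (ξ + 1) / k)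
    have h2 := Real.arctan_lt_pi_div_two (p ξ / h ξ / k)
    linarith
  have : k ≤ Real.pi / m := by
    rw [le_div_iff₀ hm]
    linarith
  gcongr

/-- By monotonicity the slopes for `c - 1 / (n + 1)` all lie in the compact slope set for `c - 1`; a
limit point works for `c` by continuity in the parameter. -/
theorem Coef.posSlope_of_forall_lt (C : Coef γ w ξ) {c : ℝ}
    (hc : ∀ c' < c, ∃ z, PosSlope γ w ξ c' z) : ∃ z, PosSlope γ w ξ c z := by
  obtain ⟨y₁, y₂, hcont, hiff, -⟩ := C.exists_posSlope_iff
  have hlt : ∀ n : ℕ, c - 1 / ((n : ℝ) + 1) < c := fun n => sub_lt_self _ (by positivity)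
  choose z hz using fun n : ℕ => hc _ (hlt n)
  have hmem : ∀ n, z n ∈ {z | PosSlope γ w ξ (c - 1) z} := fun n =>
    C.posSlope_mono (sub_le_sub_left (div_le_self zero_le_one (by simp)) _) (hz n)
  obtain ⟨z₀, -, φ, hφ, hlim⟩ := (C.isCompact_posSlope (c - 1)).tendsto_subseq hmem
  refine ⟨z₀, (hiff c z₀).2 fun x hx => ?_⟩
  have hcn : Tendsto (fun n : ℕ => c - 1 / ((φ n : ℝ) + 1)) atTop (𝓝 c) := by
    simpa using tendsto_const_nhds.sub
      ((tendsto_one_div_add_atTop_nhds_zero_nat (𝕜 := ℝ)).comp hφ.tendsto_atTop)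
  refine ge_of_tendsto' ((((hcont x hx).1.tendsto c).comp hcn).add
    (hlim.mul (((hcont x hx).2.tendsto c).comp hcn))) fun n => ?_
  exact (hiff _ _).1 (hz (φ n)) x hx

end Solutions

/-! ### Solutions of largest slope and their boundary behaviour. -/

section Maximal

variable {γ w : ℝ → ℝ} {ξ c z : ℝ} {h p : ℝ → ℝ}

theorem Coef.scale_mono (C : Coef γ w ξ) {x y : ℝ} (hx : 0 < x) (hxy : x ≤ y) :
    ∫ s in ξ..x, γ s ≤ ∫ s in ξ..y, γ s :=
  le_of_hasDerivAt_nonneg hxy (fun _ ht => C.hasDerivAt_scale (hx.trans_le ht.1))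
    fun t ht => (C.posγ t (hx.trans_le ht.1)).le

theorem Coef.scale_nonneg (C : Coef γ w ξ) {x : ℝ} (hx : ξ ≤ x) : 0 ≤ ∫ s in ξ..x, γ s := by
  simpa using C.scale_mono C.posξ hx

theorem Coef.scale_nonpos (C : Coef γ w ξ) {x : ℝ} (hx0 : 0 < x) (hx : x ≤ ξ) :
    ∫ s in ξ..x, γ s ≤ 0 := by
  simpa using C.scale_mono hx0 hx

theorem Coef.exists_lt_scale (C : Coef γ w ξ) (hγ : ¬ IntegrableOn γ (Ioi ξ)) (K x₀ : ℝ) :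
    ∃ x, x₀ ≤ x ∧ ξ ≤ x ∧ K < ∫ s in ξ..x, γ s := by
  by_contra! hcon
  refine hγ (integrableOn_Ioi_of_abs_le_deriv C.posξ C.contγ
    (F := fun x => ∫ s in ξ..x, γ s) (F' := γ) (C := K)
    (fun x hx => C.hasDerivAt_scale (C.posξ.trans_le hx))
    (fun x hx => (abs_of_pos (C.posγ x (C.posξ.trans_le hx))).le) fun x hx => ?_)
  exact (C.scale_mono (C.posξ.trans_le hx) (le_max_right x₀ x)).trans
    (hcon _ (le_max_left _ _) (hx.trans (le_max_right _ _)))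

/-- A normalized positive solution of largest slope has `∫₀ γ / h² = ∞`. -/
theorem PosSol.not_bounded_of_max (C : Coef γ w ξ) (H : PosSol γ w ξ c z h p)
    (hmax : ∀ z', PosSlope γ w ξ c z' → z' ≤ z) {F F' : ℝ → ℝ} {x₀ b : ℝ} (hx₀ : 0 < x₀)
    (hF : ∀ x ∈ Ioc 0 x₀, HasDerivAt F (F' x) x) (hle : ∀ x ∈ Ioc 0 x₀, γ x / h x ^ 2 ≤ F' x)
    (hb : ∀ x ∈ Ioc 0 x₀, b ≤ F x) : False := by
  have hc : ContinuousOn (fun x => γ x / h x ^ 2) (Ioi 0) :=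
    C.contγ.div (H.continuousOn.pow 2) fun x hx => (pow_pos (H.pos x hx) 2).ne'
  set T := fun x => ∫ s in ξ..x, γ s / h s ^ 2 with hT
  have dT : ∀ x, 0 < x → HasDerivAt T (γ x / h x ^ 2) x :=
    fun x hx => hasDerivAt_primitive hc C.posξ hx
  have hT0 : T ξ = 0 := by simp [hT]
  obtain ⟨K, hK, hTK⟩ : ∃ K, 0 < K ∧ ∀ x, 0 < x → -K < T x := by
    have hF0 : 0 ≤ F x₀ - b := sub_nonneg.2 (hb x₀ (right_mem_Ioc.2 hx₀))
    refine ⟨|T x₀| + (F x₀ - b) + 1, by positivity, fun x hx => ?_⟩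
    have h1 := neg_abs_le (T x₀)
    rcases le_total x x₀ with hxx | hxx
    · have h2 := sub_le_sub_of_hasDerivAt_le hxx (fun t ht => dT t (hx.trans_le ht.1))
        (fun t ht => hF t ⟨hx.trans_le ht.1, ht.2⟩) fun t ht => hle t ⟨hx.trans_le ht.1, ht.2⟩
      have h3 := hb x ⟨hx, hxx⟩
      linarith
    · have h2 := le_of_hasDerivAt_nonneg hxx (fun t ht => dT t (hx₀.trans_le ht.1))
        fun t ht => div_nonneg (C.posγ t (hx₀.trans_le ht.1)).le (sq_nonneg _)
      linarith
  -- Reduction of order: `h ∫ γ / h²` is a second solution. Adding `1 / K` times it keeps positivity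
  -- because `T > -K`, and raises the slope.
  have hnew : PosSol γ w ξ c (z + 1 / K) (fun x => h x * (1 + T x / K))
      (fun x => p x * (1 + T x / K) + 1 / K / h x) :=
    { dh := fun x hx => by
        have hh := (H.pos x hx).ne'
        refine ((H.dh x hx).mul (((dT x hx).div_const K).const_add 1)).congr_deriv ?_
        field_simp
      dp := fun x hx => by
        have hh := (H.pos x hx).ne'
        refine (((H.dp x hx).mul (((dT x hx).div_const K).const_add 1)).add
          ((hasDerivAt_const x (1 / K)).div (H.dh x hx) hh)).congr_deriv ?_
        field_simp
        ring
      val := by simp [hT0, H.val]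
      slope := by simp [hT0, H.val, H.slope]
      pos := fun x hx => by
        refine mul_pos (H.pos x hx) ?_
        have : -1 < T x / K := by
          rw [lt_div_iff₀ hK]
          linarith [hTK x hx]
        linarith }
  have h1 := hmax _ ⟨_, _, hnew⟩
  have h2 : 0 < 1 / K := by positivity
  linarith

/-- The Wronskian is nondecreasing, so a value `-δ < 0` at `x` persists down to `0`. There `(g / h)'
≥ δ γ / h²`, although `g / h` is positive. -/
theorem PosSol.wronskian_nonneg_of_max (C : Coef γ w ξ) (H : PosSol γ w ξ c z h p)
    (hmax : ∀ z', PosSlope γ w ξ c z' → z' ≤ z) {c' z' : ℝ} {g q : ℝ → ℝ} (hcc : c ≤ c')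
    (G : PosSol γ w ξ c' z' g q) {x : ℝ} (hx : 0 < x) : 0 ≤ p x * g x - h x * q x := by
  by_contra! hneg
  set δ := -(p x * g x - h x * q x) with hδ
  have hδ0 : 0 < δ := neg_pos.2 hneg
  refine H.not_bounded_of_max C hmax hx (F := fun y => g y / h y / δ) (b := 0)
    (fun y hy => (G.toSol.hasDerivAt_div H.toSol hy.1 (H.pos y hy.1).ne').div_const δ)
    (fun y hy => ?_)
    (fun y hy => div_nonneg (div_nonneg (G.pos y hy.1).le (H.pos y hy.1).le) hδ0.le)
  have h1 : p y * g y - h y * q y ≤ p x * g x - h x * q x :=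
    le_of_hasDerivAt_nonneg hy.2
      (fun t ht => H.toSol.hasDerivAt_wronskian G.toSol (hy.1.trans_le ht.1)) fun t ht => by
        have ht0 := hy.1.trans_le ht.1
        have := C.posw t ht0
        have := H.pos t ht0
        have := G.pos t ht0
        have := sub_nonneg.2 hcc
        positivity
  have h2 := C.posγ y hy.1
  have h3 := H.pos y hy.1
  rw [le_div_iff₀ hδ0, div_mul_eq_mul_div]
  gcongr
  linarith

theorem PosSol.monotoneOn (C : Coef γ w ξ) (H : PosSol γ w ξ c z h p)
    (hp : ∀ x, 0 < x → 0 ≤ p x) : MonotoneOn h (Ioi 0) := fun _ hx _ _ hxy =>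
  le_of_hasDerivAt_nonneg hxy (fun t ht => H.dh t (lt_of_lt_of_le hx ht.1)) fun t ht =>
    mul_nonneg (C.posγ t (lt_of_lt_of_le hx ht.1)).le (hp t (lt_of_lt_of_le hx ht.1))

/-! ### The case `c < 0`. -/

section Negative

/-- Here `p` increases strictly, so a nonpositive value forces `p ≤ -δ < 0` near `0`; then `(1 / h)'
≥ δ γ / h²` with `1 / h` positive. -/
theorem PosSol.deriv_pos_of_neg (C : Coef γ w ξ) (H : PosSol γ w ξ c z h p)
    (hmax : ∀ z', PosSlope γ w ξ c z' → z' ≤ z) (hc : c < 0) {x : ℝ} (hx : 0 < x) : 0 < p x := by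
  by_contra! hneg
  have hdp : ∀ t, 0 < t → 0 < -c * w t * h t := fun t ht =>
    mul_pos (mul_pos (neg_pos.2 hc) (C.posw t ht)) (H.pos t ht)
  -- Moving left to `x / 2` turns `p x ≤ 0` into strict negativity.
  have hx2 : 0 < x / 2 := half_pos hx
  have h1 : p (x / 2) < p x := lt_of_hasDerivAt_pos (half_lt_self hx)
    (fun t ht => H.dp t (hx2.trans_le ht.1)) fun t ht => hdp t (hx2.trans_le ht.1)
  set δ := -p (x / 2) with hδ
  have hδ0 : 0 < δ := by linarith
  refine H.not_bounded_of_max C hmax hx2 (F := fun y => 1 / h y / δ) (b := 0)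
    (fun y hy => ((hasDerivAt_const y (1 : ℝ)).div (H.dh y hy.1) (H.pos y hy.1).ne').div_const δ)
    (fun y hy => ?_) (fun y hy => div_nonneg (one_div_nonneg.2 (H.pos y hy.1).le) hδ0.le)
  have h2 : p y ≤ p (x / 2) := le_of_hasDerivAt_nonneg hy.2
    (fun t ht => H.dp t (hy.1.trans_le ht.1)) fun t ht => (hdp t (hy.1.trans_le ht.1)).le
  have h3 := H.pos y hy.1
  have h4 := C.posγ y hy.1
  rw [le_div_iff₀ hδ0, div_mul_eq_mul_div]
  gcongr
  nlinarith

/-- With `S` the scale, `(h - S p)' = c w S h`. If `h ≥ l > 0`, this dominates `-c l |w S|` on `(0,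
ξ]`, while `h - S p ≥ 0` there, so `w S` would be integrable. -/
theorem PosSol.tendsto_zero_of_neg (C : Coef γ w ξ) (H : PosSol γ w ξ c z h p)
    (hp : ∀ x, 0 < x → 0 < p x) (hc : c < 0)
    (hQ : ¬ IntegrableOn (fun x => w x * ∫ s in ξ..x, γ s) (Ioo 0 ξ)) :
    Tendsto h (𝓝[>] 0) (𝓝 0) := by
  refine tendsto_nhdsGT_zero_of_monotoneOn (H.monotoneOn C fun x hx => (hp x hx).le) H.pos ?_
  by_contra! hcon
  obtain ⟨l, hl, hle⟩ := hcon
  have hcl : 0 < -c * l := mul_pos (neg_pos.2 hc) hl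
  refine hQ (integrableOn_Ioo_of_abs_le_deriv C.posξ
    (C.contw.mul (continuousOn_primitive C.contγ C.posξ))
    (F := fun x => (h x - (∫ s in ξ..x, γ s) * p x) / (-c * l)) (C := 0)
    (fun x hx => ((H.dh x hx.1).sub ((C.hasDerivAt_scale hx.1).mul (H.dp x hx.1))).div_const _)
    (fun x hx => ?_) fun x hx => ?_)
  · have h1 := C.scale_nonpos hx.1 hx.2
    have h2 := C.posw x hx.1
    rw [abs_mul, abs_of_pos h2, abs_of_nonpos h1, le_div_iff₀ hcl]
    have h3 : w x * -(∫ s in ξ..x, γ s) * (-c * l) ≤ w x * -(∫ s in ξ..x, γ s) * (-c * h x) := by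
      have := hle x hx.1
      have := neg_nonneg.2 h1
      have := neg_pos.2 hc
      gcongr
    linarith
  · have h1 := C.scale_nonpos hx.1 hx.2
    have h2 := H.pos x hx.1
    have h3 := mul_nonneg (neg_nonneg.2 h1) (hp x hx.1).le
    exact div_nonneg (by linarith) hcl.le

/-- Right of `ξ`, `h ≥ 1` gives `p ≥ -c ∫ w`, so `h'` dominates `-c γ ∫ w`; bounded `h` would make
the latter integrable. -/
theorem PosSol.tendsto_top_of_neg (C : Coef γ w ξ) (H : PosSol γ w ξ c z h p)
    (hp : ∀ x, 0 < x → 0 < p x) (hc : c < 0)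
    (hR : ¬ IntegrableOn (fun x => γ x * ∫ s in ξ..x, w s) (Ioi ξ)) :
    Tendsto h atTop atTop := by
  have hm := H.monotoneOn C fun x hx => (hp x hx).le
  refine tendsto_atTop_of_monotoneOn hm ?_
  by_contra! hcon
  obtain ⟨K, hK⟩ := hcon
  have dV := fun x (hx : 0 < x) => hasDerivAt_primitive C.contw C.posξ hx
  have hc' : 0 < -c := neg_pos.2 hc
  refine hR (integrableOn_Ioi_of_abs_le_deriv C.posξ
    (C.contγ.mul (continuousOn_primitive C.contw C.posξ))
    (F := fun x => h x / -c) (C := K / -c)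
    (fun x hx => (H.dh x (C.posξ.trans_le hx)).div_const _) (fun x hx => ?_) fun x hx => ?_)
  · have hx0 := C.posξ.trans_le hx
    have h1 : 0 ≤ ∫ s in ξ..x, w s := by
      have := le_of_hasDerivAt_nonneg hx (fun t ht => dV t (C.posξ.trans_le ht.1))
        fun t ht => (C.posw t (C.posξ.trans_le ht.1)).le
      simpa using this
    have h2 := C.posγ x hx0
    rw [abs_mul, abs_of_pos h2, abs_of_nonneg h1, le_div_iff₀ hc', mul_assoc]
    gcongr
    have h3 := sub_le_sub_of_hasDerivAt_le hx
      (fun t ht => (dV t (C.posξ.trans_le ht.1)).mul_const (-c))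
      (fun t ht => H.dp t (C.posξ.trans_le ht.1)) fun t ht => by
        have ht0 := C.posξ.trans_le ht.1
        have h4 : 1 ≤ h t := H.val ▸ hm C.posξ ht0 ht.1
        have h5 := mul_pos (C.posw t ht0) hc'
        nlinarith
    have h4 := hp ξ C.posξ
    simp only [intervalIntegral.integral_same, zero_mul, sub_zero] at h3
    linarith
  · exact div_le_div_of_nonneg_right (hK x (C.posξ.trans_le hx)) hc'.le

end Negative

/-! ### The case `c ≥ 0`: concavity in the scale. -/

section Nonnegative

theorem PosSol.deriv_antitone (C : Coef γ w ξ) (H : PosSol γ w ξ c z h p) (hc : 0 ≤ c)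
    {x y : ℝ} (hx : 0 < x) (hxy : x ≤ y) : p y ≤ p x := by
  have := le_of_hasDerivAt_nonneg (f := fun t => -p t) hxy
    (fun t ht => (H.dp t (hx.trans_le ht.1)).neg) fun t ht => by
      have ht0 := hx.trans_le ht.1
      have := mul_nonneg (mul_nonneg hc (C.posw t ht0).le) (H.pos t ht0).le
      linarith
  linarith

theorem PosSol.deriv_strictAnti (C : Coef γ w ξ) (H : PosSol γ w ξ c z h p) (hc : 0 < c)
    {x y : ℝ} (hx : 0 < x) (hxy : x < y) : p y < p x := by
  have := lt_of_hasDerivAt_pos (f := fun t => -p t) hxy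
    (fun t ht => (H.dp t (hx.trans_le ht.1)).neg) fun t ht => by
      have ht0 := hx.trans_le ht.1
      have := mul_pos (mul_pos hc (C.posw t ht0)) (H.pos t ht0)
      linarith
  linarith

/-- Solutions with `c ≥ 0` are concave in the scale. -/
theorem PosSol.sub_le_scale (C : Coef γ w ξ) (H : PosSol γ w ξ c z h p) (hc : 0 ≤ c)
    {x y : ℝ} (hx : 0 < x) (hxy : x ≤ y) :
    h y - h x ≤ p x * ((∫ s in ξ..y, γ s) - ∫ s in ξ..x, γ s) := by
  have := sub_le_sub_of_hasDerivAt_le hxy (fun t ht => H.dh t (hx.trans_le ht.1))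
    (fun t ht => (C.hasDerivAt_scale (hx.trans_le ht.1)).const_mul (p x)) fun t ht => by
      have h1 := H.deriv_antitone C hc hx ht.1
      have h2 := C.posγ t (hx.trans_le ht.1)
      nlinarith
  linarith

/-- A negative slope would, by concavity and the unbounded scale, push `h` below zero. -/
theorem PosSol.deriv_nonneg (C : Coef γ w ξ) (H : PosSol γ w ξ c z h p) (hc : 0 ≤ c)
    (hγ : ¬ IntegrableOn γ (Ioi ξ)) {x : ℝ} (hx : 0 < x) : 0 ≤ p x := by
  by_contra! hneg
  obtain ⟨y, hxy, -, hy⟩ := C.exists_lt_scale hγ ((∫ s in ξ..x, γ s) + h x / -p x) x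
  have h1 := H.sub_le_scale C hc hx hxy
  have h2 := H.pos y (hx.trans_le hxy)
  have h3 : h x < ((∫ s in ξ..y, γ s) - ∫ s in ξ..x, γ s) * -p x := by
    rw [← div_lt_iff₀ (neg_pos.2 hneg)]
    linarith
  linarith

/-- On `(0, ξ]`, `h' ≥ p ξ γ` with `p ξ > 0`; since `h` falls by less than `1` from `ξ` towards `0`,
the scale falls by at most `1 / p ξ`. -/
theorem PosSol.exists_le_scale (C : Coef γ w ξ) (H : PosSol γ w ξ c z h p) (hc : 0 < c)
    (hγ : ¬ IntegrableOn γ (Ioi ξ)) : ∃ b, ∀ x ∈ Ioc 0 ξ, b ≤ ∫ s in ξ..x, γ s := by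
  have hq : 0 < p ξ := (H.deriv_nonneg C hc.le hγ (by linarith [C.posξ] : 0 < ξ + 1)).trans_lt
    (H.deriv_strictAnti C hc C.posξ (by linarith))
  refine ⟨-1 / p ξ, fun x hx => ?_⟩
  have h1 := sub_le_sub_of_hasDerivAt_le hx.2
    (fun t ht => (C.hasDerivAt_scale (hx.1.trans_le ht.1)).const_mul (p ξ))
    (fun t ht => H.dh t (hx.1.trans_le ht.1)) fun t ht => by
      have h1 := H.deriv_antitone C hc.le (hx.1.trans_le ht.1) ht.2
      have h2 := C.posγ t (hx.1.trans_le ht.1)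
      nlinarith
  have h2 := H.pos x hx.1
  simp only [intervalIntegral.integral_same, mul_zero, H.val] at h1
  rw [div_le_iff₀ hq]
  linarith

/-- If `h ≥ l > 0`, then `γ / h² ≤ γ / l²`, whose primitive is bounded below at `0`, against
maximality. -/
theorem PosSol.exists_lt_of_max (C : Coef γ w ξ) (H : PosSol γ w ξ c z h p)
    (hmax : ∀ z', PosSlope γ w ξ c z' → z' ≤ z) {b : ℝ}
    (hb : ∀ x ∈ Ioc 0 ξ, b ≤ ∫ s in ξ..x, γ s) : ∀ ε > 0, ∃ x, 0 < x ∧ h x < ε := by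
  by_contra! hcon
  obtain ⟨l, hl, hle⟩ := hcon
  refine H.not_bounded_of_max C hmax C.posξ (F := fun x => (∫ s in ξ..x, γ s) / l ^ 2)
    (b := b / l ^ 2) (fun x hx => (C.hasDerivAt_scale hx.1).div_const _) (fun x hx => ?_)
    fun x hx => div_le_div_of_nonneg_right (hb x hx) (sq_nonneg _)
  have h1 := C.posγ x hx.1
  have h2 := hle x hx.1
  gcongr

/-- For `c > 0` strict decrease of `p` suffices. For `c = 0` a zero of `p` makes `h` constant by
uniqueness, which contradicts its arbitrarily small values. -/
theorem PosSol.deriv_pos_of_nonneg (C : Coef γ w ξ) (H : PosSol γ w ξ c z h p) (hc : 0 ≤ c)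
    (hγ : ¬ IntegrableOn γ (Ioi ξ)) (h0 : ∀ ε > 0, ∃ x, 0 < x ∧ h x < ε) {x : ℝ} (hx : 0 < x) :
    0 < p x := by
  rcases hc.eq_or_lt with rfl | hc
  · refine lt_of_le_of_ne (H.deriv_nonneg C le_rfl hγ hx) fun hp => ?_
    have h1 : Sol γ w 0 (fun _ => 1) (fun _ => 0) :=
      ⟨fun x _ => by simpa using hasDerivAt_const x (1 : ℝ),
        fun x _ => by simpa using hasDerivAt_const x (0 : ℝ)⟩
    obtain ⟨y, hy, hyx⟩ := h0 _ (H.pos x hx)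
    have h2 := (H.toSol.lin h1 1 (-h x)).eq_zero C hx (by simp) (by simp [← hp]) hy
    linarith
  · exact (H.deriv_nonneg C hc.le hγ (by linarith : 0 < x + 1)).trans_lt
      (H.deriv_strictAnti C hc hx (by linarith))

/-- Maximality and `c < c'` keep the Wronskian with `g` above some `δ > 0` on `[ξ, ∞)`, so `p g ≥ δ`
because `h q ≥ 0`. Concavity gives `g ≤ 1 + a S`, hence `h' ≥ δ γ / (1 + a S)`, which integrates to
a logarithm of the unbounded scale. -/
theorem PosSol.exists_gt_of_lt (C : Coef γ w ξ) (H : PosSol γ w ξ c z h p)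
    (hmax : ∀ z', PosSlope γ w ξ c z' → z' ≤ z) (hc : 0 ≤ c) (hγ : ¬ IntegrableOn γ (Ioi ξ))
    {c' z' : ℝ} {g q : ℝ → ℝ} (G : PosSol γ w ξ c' z' g q) (hcc : c < c') (K : ℝ) :
    ∃ x, 0 < x ∧ K < h x := by
  have hW : ∀ t, 0 < t → 0 < (c' - c) * w t * (h t * g t) := fun t ht =>
    mul_pos (mul_pos (sub_pos.2 hcc) (C.posw t ht)) (mul_pos (H.pos t ht) (G.pos t ht))
  have hξ2 := half_pos C.posξ
  -- Strict growth of the Wronskian from `ξ / 2`, where it is nonnegative, makes it positive at `ξ`.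
  obtain ⟨δ, hδ, hδW⟩ : ∃ δ, 0 < δ ∧ ∀ x, ξ ≤ x → δ ≤ p x * g x - h x * q x :=
    ⟨p ξ * g ξ - h ξ * q ξ,
      (H.wronskian_nonneg_of_max C hmax hcc.le G hξ2).trans_lt
        (lt_of_hasDerivAt_pos (half_lt_self C.posξ)
          (fun t ht => H.toSol.hasDerivAt_wronskian G.toSol (hξ2.trans_le ht.1))
          fun t ht => hW t (hξ2.trans_le ht.1)),
      fun x hx => le_of_hasDerivAt_nonneg hx
          (fun t ht => H.toSol.hasDerivAt_wronskian G.toSol (C.posξ.trans_le ht.1))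
          fun t ht => (hW t (C.posξ.trans_le ht.1)).le⟩
  have hc' : 0 ≤ c' := hc.trans hcc.le
  have hq : ∀ x, 0 < x → 0 ≤ q x := fun x hx => G.deriv_nonneg C hc' hγ hx
  obtain ⟨a, ha, haq⟩ : ∃ a, 0 < a ∧ q ξ ≤ a := ⟨q ξ + 1, by linarith [hq ξ C.posξ], by linarith⟩
  obtain ⟨x, -, hx, hxS⟩ := C.exists_lt_scale hγ (Real.exp (a * K / δ) / a) ξ
  refine ⟨x, C.posξ.trans_le hx, ?_⟩
  have hS : ∀ t, ξ ≤ t → 0 < 1 + a * ∫ s in ξ..t, γ s := fun t ht => by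
    have := C.scale_nonneg ht
    positivity
  have key := sub_le_sub_of_hasDerivAt_le hx
    (f := fun t => δ / a * Real.log (1 + a * ∫ s in ξ..t, γ s))
    (fun t ht => (((((C.hasDerivAt_scale (C.posξ.trans_le ht.1)).const_mul a).const_add 1).log
      (hS t ht.1).ne').const_mul (δ / a)))
    (fun t ht => H.dh t (C.posξ.trans_le ht.1)) fun t ht => by
      have ht0 := C.posξ.trans_le ht.1
      have h1 := G.sub_le_scale C hc' C.posξ ht.1
      rw [G.val, intervalIntegral.integral_same, sub_zero] at h1
      have h2 : g t ≤ 1 + a * ∫ s in ξ..t, γ s := by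
        have := mul_le_mul_of_nonneg_right haq (C.scale_nonneg ht.1)
        linarith
      have h3 := mul_nonneg (H.pos t ht0).le (hq t ht0)
      have h4 := hδW t ht.1
      have h5 : δ ≤ p t * (1 + a * ∫ s in ξ..t, γ s) := by
        have := mul_le_mul_of_nonneg_left h2 (H.deriv_nonneg C hc hγ ht0)
        linarith
      have h6 : δ / (1 + a * ∫ s in ξ..t, γ s) ≤ p t := by rwa [div_le_iff₀ (hS t ht.1)]
      have h7 := mul_le_mul_of_nonneg_left h6 (C.posγ t ht0).le
      refine le_trans (le_of_eq ?_) h7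
      have := (hS t ht.1).ne'
      field_simp
  simp only [intervalIntegral.integral_same, mul_zero, add_zero, Real.log_one, sub_zero,
    H.val] at key
  have h1 : a * K / δ < Real.log (1 + a * ∫ s in ξ..x, γ s) := by
    rw [Real.lt_log_iff_exp_lt (hS x hx)]
    rw [div_lt_iff₀ ha] at hxS
    linarith
  have h2 : K < δ / a * Real.log (1 + a * ∫ s in ξ..x, γ s) := by
    calc K = δ / a * (a * K / δ) := by field_simp
      _ < _ := by gcongr
  linarith

/-- Right of `ξ`, `(h - S p)' = c w S h ≥ c w S`, while `h - S p ≤ h`; a bound on `h` would make `w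
S` integrable. -/
theorem PosSol.exists_gt_of_natural (C : Coef γ w ξ) (H : PosSol γ w ξ c z h p) (hc : 0 < c)
    (hp : ∀ x, 0 < x → 0 ≤ p x)
    (hQ : ¬ IntegrableOn (fun x => w x * ∫ s in ξ..x, γ s) (Ioi ξ)) (K : ℝ) :
    ∃ x, 0 < x ∧ K < h x := by
  by_contra! hcon
  refine hQ (integrableOn_Ioi_of_abs_le_deriv C.posξ
    (C.contw.mul (continuousOn_primitive C.contγ C.posξ))
    (F := fun x => (h x - (∫ s in ξ..x, γ s) * p x) / c) (C := K / c)
    (fun x hx => ((H.dh x (C.posξ.trans_le hx)).sub ((C.hasDerivAt_scale (C.posξ.trans_le hx)).mul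
      (H.dp x (C.posξ.trans_le hx)))).div_const _)
    (fun x hx => ?_) fun x hx => ?_)
  · have hx0 := C.posξ.trans_le hx
    have h1 := C.scale_nonneg hx
    have h2 := C.posw x hx0
    have h3 : 1 ≤ h x := H.val ▸ H.monotoneOn C hp C.posξ hx0 hx
    rw [abs_mul, abs_of_pos h2, abs_of_nonneg h1, le_div_iff₀ hc]
    have h4 : w x * (∫ s in ξ..x, γ s) * c * 1 ≤ w x * (∫ s in ξ..x, γ s) * c * h x := by gcongr
    linarith
  · have hx0 := C.posξ.trans_le hx
    have h1 := mul_nonneg (C.scale_nonneg hx) (hp x hx0)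
    refine div_le_div_of_nonneg_right ?_ hc.le
    linarith [hcon x hx0]

theorem PosSol.not_tendsto_top (C : Coef γ w ξ) (H : PosSol γ w ξ c z h p) (hc : 0 ≤ c)
    (hγ : IntegrableOn γ (Ioi ξ)) : ¬ Tendsto h atTop atTop := by
  intro ht
  obtain ⟨x, hx, hxξ⟩ := ((ht.eventually_gt_atTop (1 + |p ξ| * ∫ s in Ioi ξ, γ s)).and
    (eventually_ge_atTop ξ)).exists
  have h1 := H.sub_le_scale C hc C.posξ hxξ
  rw [H.val, intervalIntegral.integral_same, sub_zero] at h1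
  have h2 : ∫ s in ξ..x, γ s ≤ ∫ s in Ioi ξ, γ s := by
    rw [intervalIntegral.integral_of_le hxξ]
    refine setIntegral_mono_set hγ ?_ Ioc_subset_Ioi_self.eventuallyLE
    filter_upwards [ae_restrict_mem measurableSet_Ioi] with s hs
    exact (C.posγ s (C.posξ.trans hs)).le
  have h3 := C.scale_nonneg hxξ
  have h4 : p ξ * ∫ s in ξ..x, γ s ≤ |p ξ| * ∫ s in Ioi ξ, γ s := by
    gcongr
    exact le_abs_self _
  linarith

end Nonnegative

end Maximal

/-! ### Translation to candidate tuples and the usual set. -/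

namespace Model

variable (m : Model)

/-- The density of the speed measure. -/
noncomputable def speed (x : ℝ) : ℝ := 2 / (m.σ x ^ 2 * m.γ x)

theorem continuousOn_logDeriv : ContinuousOn (fun x => 2 * m.k x / m.σ x ^ 2) (Ioi 0) :=
  (continuousOn_const.mul (m.b_smooth.continuousOn.sub
    (m.σ_smooth.continuousOn.mul m.v_smooth.continuousOn))).div
      (m.σ_smooth.continuousOn.pow 2) fun x hx => pow_ne_zero 2 (m.σ_ne_zero x hx)

theorem γ_pos (x : ℝ) : 0 < m.γ x := Real.exp_pos _

theorem γ_base : m.γ m.ξ = 1 := by simp [γ]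

theorem hasDerivAt_γ {x : ℝ} (hx : 0 < x) :
    HasDerivAt m.γ (m.γ x * -(2 * m.k x / m.σ x ^ 2)) x :=
  (hasDerivAt_primitive m.continuousOn_logDeriv m.ξ_pos hx).neg.exp

theorem continuousOn_γ : ContinuousOn m.γ (Ioi 0) :=
  fun _ hx => (m.hasDerivAt_γ hx).continuousAt.continuousWithinAt

theorem coef : Coef m.γ m.speed m.ξ where
  contγ := m.continuousOn_γ
  contw := continuousOn_const.div ((m.σ_smooth.continuousOn.pow 2).mul m.continuousOn_γ)
    fun x hx => mul_ne_zero (pow_ne_zero 2 (m.σ_ne_zero x hx)) (m.γ_pos x).ne'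
  posγ x _ := m.γ_pos x
  posw x hx := div_pos two_pos (mul_pos (sq_pos_of_ne_zero (m.σ_ne_zero x hx)) (m.γ_pos x))
  posξ := m.ξ_pos

variable {m} {r : ℝ}

theorem IsCandidatePair.posSol (hr : ∀ x, 0 < x → m.r x = r) {lam : ℝ} {h : ℝ → ℝ}
    (H : m.IsCandidatePair lam h) :
    PosSol m.γ m.speed m.ξ (lam - r) (deriv h m.ξ) h (fun x => deriv h x / m.γ x) := by
  have h2 := (contDiffOn_succ_iff_deriv_of_isOpen (n := 1) isOpen_Ioi).1 H.smooth
  have hd1 : ∀ x, 0 < x → HasDerivAt h (deriv h x) x := fun x hx =>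
    (h2.1.differentiableAt (Ioi_mem_nhds hx)).hasDerivAt
  have hd2 : ∀ x, 0 < x → HasDerivAt (deriv h) (deriv (deriv h) x) x := fun x hx =>
    ((h2.2.2.differentiableOn one_ne_zero).differentiableAt (Ioi_mem_nhds hx)).hasDerivAt
  refine ⟨⟨fun x hx => ?_, fun x hx => ?_⟩, H.normalized, by simp [m.γ_base], H.pos⟩
  · exact (hd1 x hx).congr_deriv (by rw [mul_div_cancel₀ _ (m.γ_pos x).ne'])
  · refine ((hd2 x hx).div (m.hasDerivAt_γ hx) (m.γ_pos x).ne').congr_deriv ?_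
    have hγ := (m.γ_pos x).ne'
    have hσ := m.σ_ne_zero x hx
    have he := H.eigen x hx
    rw [L, hr x hx] at he
    rw [speed]
    field_simp
    linear_combination 2 * he

theorem isCandidatePair_of_posSol (hr : ∀ x, 0 < x → m.r x = r) {lam z : ℝ} {h p : ℝ → ℝ}
    (H : PosSol m.γ m.speed m.ξ (lam - r) z h p) :
    m.IsCandidatePair lam h ∧ deriv h m.ξ = z ∧ ∀ x, 0 < x → deriv h x = m.γ x * p x := by
  have hd : ∀ x, 0 < x → deriv h x = m.γ x * p x := fun x hx => (H.dh x hx).deriv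
  have hd2 : ∀ x, 0 < x → HasDerivAt (deriv h)
      (m.γ x * -(2 * m.k x / m.σ x ^ 2) * p x + m.γ x * (-(lam - r) * m.speed x * h x)) x := by
    intro x hx
    refine ((m.hasDerivAt_γ hx).mul (H.dp x hx)).congr_of_eventuallyEq ?_
    filter_upwards [Ioi_mem_nhds hx] with y hy
    exact hd y hy
  refine ⟨⟨?_, fun x hx => ?_, H.pos, H.val⟩, ?_, hd⟩
  · refine (contDiffOn_succ_iff_deriv_of_isOpen (n := 1) isOpen_Ioi).2
      ⟨fun x hx => (H.dh x hx).differentiableAt.differentiableWithinAt, by simp,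
        (contDiffOn_succ_iff_deriv_of_isOpen (n := 0) isOpen_Ioi).2
          ⟨fun x hx => (hd2 x hx).differentiableAt.differentiableWithinAt, by simp, ?_⟩⟩
    rw [contDiffOn_zero]
    refine ContinuousOn.congr ?_ fun x hx => (hd2 x hx).deriv
    exact ((m.continuousOn_γ.mul m.continuousOn_logDeriv.neg).mul H.toSol.continuousOn_deriv).add
      (m.continuousOn_γ.mul ((continuousOn_const.mul m.coef.contw).mul H.continuousOn))
  · rw [L, hr x hx, (hd2 x hx).deriv, hd x hx, speed]
    have hγ := (m.γ_pos x).ne'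
    have hσ := m.σ_ne_zero x hx
    field_simp
    ring
  · rw [hd _ m.ξ_pos, m.γ_base, one_mul, H.slope]

theorem mem_candidates_iff (hr : ∀ x, 0 < x → m.r x = r) {lam z : ℝ} :
    (lam, z) ∈ m.candidates ↔ PosSlope m.γ m.speed m.ξ (lam - r) z := by
  constructor
  · rintro ⟨h, H, hz⟩
    exact ⟨h, _, hz ▸ H.posSol hr⟩
  · rintro ⟨h, p, H⟩
    have := isCandidatePair_of_posSol hr H
    exact ⟨h, this.1, this.2.1⟩

theorem exists_candidate_self (hr : ∀ x, 0 < x → m.r x = r) : ∃ z, (r, z) ∈ m.candidates :=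
  ⟨0, (mem_candidates_iff hr).2 ⟨fun _ => 1, fun _ => 0,
    { dh := fun x _ => by simpa using hasDerivAt_const x (1 : ℝ)
      dp := fun x _ => by simpa using hasDerivAt_const x (0 : ℝ)
      val := rfl
      slope := rfl
      pos := fun _ _ => one_pos }⟩⟩

theorem bddAbove_candidates (hr : ∀ x, 0 < x → m.r x = r) :
    BddAbove {lam | ∃ z, (lam, z) ∈ m.candidates} := by
  obtain ⟨K, hK⟩ := m.coef.bddAbove_posSlope
  refine ⟨K + r, ?_⟩
  rintro lam ⟨z, hz⟩
  have := hK ⟨z, (mem_candidates_iff hr).1 hz⟩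
  linarith

theorem isGreatest_lamBar (hr : ∀ x, 0 < x → m.r x = r) :
    IsGreatest {lam | ∃ z, (lam, z) ∈ m.candidates} m.lamBar := by
  refine ⟨?_, fun lam hlam => le_csSup (bddAbove_candidates hr) hlam⟩
  obtain ⟨z, hz⟩ := m.coef.posSlope_of_forall_lt (c := m.lamBar - r) fun c hc => by
    obtain ⟨lam, ⟨z, hz⟩, hlt⟩ := exists_lt_of_lt_csSup ⟨r, exists_candidate_self hr⟩
      (show c + r < sSup {lam | ∃ z, (lam, z) ∈ m.candidates} from lt_sub_iff_add_lt.1 hc)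
    exact ⟨z, m.coef.posSlope_mono (by linarith) ((mem_candidates_iff hr).1 hz)⟩
  exact ⟨z, (mem_candidates_iff hr).2 hz⟩

theorem isGreatest_M (hr : ∀ x, 0 < x → m.r x = r) {lam : ℝ} (hlam : lam ≤ m.lamBar) :
    IsGreatest {z | (lam, z) ∈ m.candidates} (m.M lam) := by
  obtain ⟨z, hz⟩ := (isGreatest_lamBar hr).1
  have hne : {z | (lam, z) ∈ m.candidates}.Nonempty := ⟨z, (mem_candidates_iff hr).2
    (m.coef.posSlope_mono (by linarith) ((mem_candidates_iff hr).1 hz))⟩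
  have hc : IsCompact {z | (lam, z) ∈ m.candidates} := by
    simp_rw [mem_candidates_iff hr]
    exact m.coef.isCompact_posSlope _
  exact hc.isGreatest_sSup hne

theorem le_lamBar_of_mem_usualSet (hr : ∀ x, 0 < x → m.r x = r) {p : ℝ × ℝ}
    (hp : p ∈ m.usualSet) : p.1 ≤ m.lamBar ∧ p = (p.1, m.M p.1) := by
  obtain ⟨h1, h, H, h2, -⟩ := hp
  exact ⟨(isGreatest_lamBar hr).2 ⟨p.2, h, H, h2⟩, Prod.ext rfl h1⟩

theorem exists_posSol_max (hr : ∀ x, 0 < x → m.r x = r) {lam : ℝ} (hlam : lam ≤ m.lamBar) :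
    ∃ h p, PosSol m.γ m.speed m.ξ (lam - r) (m.M lam) h p ∧
      ∀ z', PosSlope m.γ m.speed m.ξ (lam - r) z' → z' ≤ m.M lam := by
  have hM := isGreatest_M hr hlam
  obtain ⟨h, p, H⟩ := (mem_candidates_iff hr).1 hM.1
  exact ⟨h, p, H, fun z' hz' => hM.2 ((mem_candidates_iff hr).2 hz')⟩

theorem mem_usualSet_of_posSol (hr : ∀ x, 0 < x → m.r x = r) {lam : ℝ} {h p : ℝ → ℝ}
    (H : PosSol m.γ m.speed m.ξ (lam - r) (m.M lam) h p) (hp : ∀ x, 0 < x → 0 < p x)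
    (h0 : Tendsto h (𝓝[>] 0) (𝓝 0)) (h1 : Tendsto h atTop atTop) :
    (lam, m.M lam) ∈ m.usualSet := by
  obtain ⟨e1, e2, e3⟩ := isCandidatePair_of_posSol hr H
  refine ⟨rfl, h, e1, e2, H.pos, fun x hx => ?_, h0, h1⟩
  rw [e3 x hx]
  exact mul_pos (m.γ_pos x) (hp x hx)

theorem mem_usualSet_of_lt (hr : ∀ x, 0 < x → m.r x = r) (hzero : m.NaturalZero)
    (htop : m.InaccessibleTop) (hlam : r < m.lamBar) {lam : ℝ} (h : lam < r) :
    (lam, m.M lam) ∈ m.usualSet := by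
  obtain ⟨h, p, H, hmax⟩ := exists_posSol_max hr (h.le.trans hlam.le)
  have hc : lam - r < 0 := by linarith
  have hp : ∀ x, 0 < x → 0 < p x := fun x hx => H.deriv_pos_of_neg m.coef hmax hc hx
  -- `Q` and `R` unfold to `speed` times the scale and `γ` times the primitive of `speed`, so the
  -- Feller hypotheses apply directly.
  exact mem_usualSet_of_posSol hr H hp (H.tendsto_zero_of_neg m.coef hp hc hzero.2)
    (H.tendsto_top_of_neg m.coef hp hc htop)

theorem mem_usualSet_of_le (hr : ∀ x, 0 < x → m.r x = r) (hlam : r < m.lamBar)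
    (hγ : ¬ IntegrableOn m.γ (Ioi m.ξ)) {lam : ℝ} (h : r ≤ lam) (h' : lam ≤ m.lamBar)
    (hor : lam < m.lamBar ∨ m.NaturalTop) : (lam, m.M lam) ∈ m.usualSet := by
  obtain ⟨h, p, H, hmax⟩ := exists_posSol_max hr h'
  -- The solution at `λ̄` has two uses: as `λ̄ > r` it bounds the scale below at `0`, and for `lam <
  -- λ̄` it is the comparison solution at `∞`.
  obtain ⟨g, q, G, -⟩ := exists_posSol_max hr le_rfl
  have hc : 0 ≤ lam - r := by linarith
  obtain ⟨b, hb⟩ := G.exists_le_scale m.coef (by linarith) hγ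
  have h0 := H.exists_lt_of_max m.coef hmax hb
  have hp : ∀ x, 0 < x → 0 < p x := fun x hx => H.deriv_pos_of_nonneg m.coef hc hγ h0 hx
  have hm := H.monotoneOn m.coef fun x hx => (hp x hx).le
  refine mem_usualSet_of_posSol hr H hp (tendsto_nhdsGT_zero_of_monotoneOn hm H.pos h0)
    (tendsto_atTop_of_monotoneOn hm ?_)
  rcases h'.lt_or_eq with hlt | rfl
  · exact H.exists_gt_of_lt m.coef hmax hc hγ G (by linarith)
  · exact H.exists_gt_of_natural m.coef (by linarith) (fun x hx => (hp x hx).le)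
      (hor.resolve_left (lt_irrefl _)).2

theorem lt_of_mem_usualSet (hr : ∀ x, 0 < x → m.r x = r) (hγ : IntegrableOn m.γ (Ioi m.ξ))
    {p : ℝ × ℝ} (hp : p ∈ m.usualSet) : p.1 < r := by
  obtain ⟨-, h, H, -, hu⟩ := hp
  by_contra! hle
  exact (H.posSol hr).not_tendsto_top m.coef (by linarith) hγ hu.tendsto_top

end Model

end RepAgent

/-- `γ` is continuous and positive on `(0,∞)`, so `∫_ξ^∞ γ = ∞` says that `γ` is not integrable
on `(ξ,∞)`. The first two conjuncts say that the suprema defining `λ̄` and `M_lam` are attained. -/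
theorem mainTheorem2 (m : RepAgent.Model) (r : ℝ)
    (hr : ∀ x, 0 < x → m.r x = r)
    (hzero : m.NaturalZero) (htop : m.InaccessibleTop)
    (hlam : r < m.lamBar) :
    IsGreatest {lam | ∃ z, (lam, z) ∈ m.candidates} m.lamBar ∧
    (∀ lam ≤ m.lamBar, IsGreatest {z | (lam, z) ∈ m.candidates} (m.M lam)) ∧
    (¬ IntegrableOn m.γ (Ioi m.ξ) →
      (m.usualSet = {p | ∃ lam, lam ≤ m.lamBar ∧ p = (lam, m.M lam)} ∨
        m.usualSet = {p | ∃ lam, lam < m.lamBar ∧ p = (lam, m.M lam)}) ∧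
      (m.NaturalTop → m.usualSet = {p | ∃ lam, lam ≤ m.lamBar ∧ p = (lam, m.M lam)})) ∧
    (IntegrableOn m.γ (Ioi m.ξ) →
      m.usualSet = {p | ∃ lam, lam < r ∧ p = (lam, m.M lam)}) := by
  refine ⟨RepAgent.Model.isGreatest_lamBar hr, fun lam h => RepAgent.Model.isGreatest_M hr h,
    fun hγ => ?_, fun hγ => ?_⟩
  · have hlt : ∀ lam, lam < m.lamBar → (lam, m.M lam) ∈ m.usualSet := fun lam h => by
      rcases lt_or_ge lam r with h' | h'
      · exact RepAgent.Model.mem_usualSet_of_lt hr hzero htop hlam h'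
      · exact RepAgent.Model.mem_usualSet_of_le hr hlam hγ h' h.le (Or.inl h)
    -- All parameters below `λ̄` are already settled, so the usual set is determined by whether the
    -- endpoint tuple belongs to it.
    have hall : (m.lamBar, m.M m.lamBar) ∈ m.usualSet →
        m.usualSet = {p | ∃ lam, lam ≤ m.lamBar ∧ p = (lam, m.M lam)} := fun hb => by
      refine Subset.antisymm
        (fun p hp => ⟨p.1, RepAgent.Model.le_lamBar_of_mem_usualSet hr hp⟩) ?_
      rintro p ⟨lam, h, rfl⟩
      rcases h.lt_or_eq with h' | rfl
      · exact hlt lam h'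
      · exact hb
    refine ⟨?_, fun hnat => hall
      (RepAgent.Model.mem_usualSet_of_le hr hlam hγ hlam.le le_rfl (Or.inr hnat))⟩
    by_cases hb : (m.lamBar, m.M m.lamBar) ∈ m.usualSet
    · exact Or.inl (hall hb)
    · refine Or.inr (Subset.antisymm (fun p hp => ?_) ?_)
      · obtain ⟨h1, h2⟩ := RepAgent.Model.le_lamBar_of_mem_usualSet hr hp
        refine ⟨p.1, lt_of_le_of_ne h1 fun he => hb ?_, h2⟩
        rwa [h2, he] at hp
      · rintro p ⟨lam, h, rfl⟩
        exact hlt lam h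
  · refine Subset.antisymm (fun p hp => ⟨p.1, RepAgent.Model.lt_of_mem_usualSet hr hγ hp,
      (RepAgent.Model.le_lamBar_of_mem_usualSet hr hp).2⟩) ?_
    rintro p ⟨lam, h, rfl⟩
    exact RepAgent.Model.mem_usualSet_of_lt hr hzero htop hlam h
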